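/- Let $R$ be a complete, separated topological associative unital ring in which open right ideals form a base of neighborhoods of zero. Let $H\subset R$ be a two-sided ideal such that: 1. $H$ is strongly closed, i.e. $H$ is closed in $R$, the quotient group $R/H$ is complete in the quotient topology, and for every set $X$ the induced map $R[[X]]\to(R/H)[[X]]$ is surjective. Here, for a topological abelian group $A$, $A[[X]]$ denotes the group of all infinite formal linear combinations $\sum_{x\in X}a_x x$ whose coefficients $a_x\in A$ form an $X$-indexed family converging to zero (every neighborhood of zero contains all but finitely many $a_x$); 2. $H$ is topologically left T-nilpotent, i.e. for every sequence $a_1,a_2,a_3,\dots$ of elements of $H$ the sequence of products $a_1,\ a_1a_2,\ a_1a_2a_3,\dots$ converges to zero in $R$; 3. the topological quotient ring $R/H$ is isomorphic, as a topological ring, to a product $\prod_{\gamma\in\Gamma}S_\gamma$ (with the product topology) of a family of discrete rings $S_\gamma$, each of which is simple Artinian. Then every flat left $R$-contramodule is a projective object of the category of left $R$-contramodules. Here a left $R$-contramodule is an algebra over the monad $X\mapsto R[[X]]$ on the category of sets, that is, a set $C$ with a map $\pi_C\colon R[[C]]\to C$ satisfying the equations of contraunitality and contraassociativity; the unit $X\to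 R[[X]]$ of the monad sends $x_0$ to $1\cdot x_0$, and the multiplication $R[[R[[X]]]]\to R[[X]]$ opens the parentheses, $\sum_y r_y\bigl(\sum_x s_{y,x}x\bigr)\mapsto\sum_x\bigl(\sum_y r_ys_{y,x}\bigr)x$. Every left $R$-contramodule has an underlying abelian group, with $a+b=\pi_C(1\cdot a+1\cdot b)$. A right $R$-module $N$ is discrete if the annihilator in $R$ of each element of $N$ is open. The contratensor product $N\odot_R C$ of a discrete right $R$-module $N$ and a left $R$-contramodule $C$ is the cokernel of the difference of the two homomorphisms $N\otimes_{\mathbb Z}R[[C]]\rightrightarrows N\otimes_{\mathbb Z}C$ taking $b\otimes\sum_c r_c c$ to $b\otimes\pi_C\bigl(\sum_c r_c c\bigr)$ and to $\sum_c (br_c)\otimes c$, respectively (the latter sum is finite). A left $R$-contramodule $F$ is flat if the functor $N\mapsto N\odot_R F$ from discrete right $R$-modules to abelian groups is exact. -/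

import Mathlib

open Filter Topology CategoryTheory
open scoped TensorProduct MulOpposite

universe u v w

/-! ### Zero-convergent formal linear combinations -/

/-- `FormalSum A X` is the group `A[[X]]` of all infinite formal linear combinations
`∑ aₓ x` of elements of `X` whose coefficients form an `X`-indexed family converging to zero in
the topology of `A`: every neighbourhood of zero contains all but finitely many `aₓ`. -/
def FormalSum (A : Type u) [AddCommGroup A] [TopologicalSpace A] [IsTopologicalAddGroup A]
    (X : Type v) : AddSubgroup (X → A) where
  carrier := {a | Tendsto a cofinite (𝓝 0)}
  zero_mem' := tendsto_const_nhds
  add_mem' {a b} ha hb := by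
    have h := Tendsto.add (show Tendsto a cofinite (𝓝 0) from ha)
      (show Tendsto b cofinite (𝓝 0) from hb)
    rw [add_zero] at h
    exact h
  neg_mem' {a} ha := by
    have h := Tendsto.neg (show Tendsto a cofinite (𝓝 0) from ha)
    rw [neg_zero] at h
    exact h

namespace FormalSum

/-- The map `A[[X]] → B[[X]]` induced by a continuous homomorphism `f : A → B` of topological
abelian groups, applied to each coefficient. -/
def mapCoeff {A : Type u} [AddCommGroup A] [TopologicalSpace A] [IsTopologicalAddGroup A]
    {B : Type v} [AddCommGroup B] [TopologicalSpace B] [IsTopologicalAddGroup B]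
    (f : A →+ B) (hf : Continuous f) (X : Type w) : FormalSum A X →+ FormalSum B X where
  toFun r := ⟨fun x => f (r.1 x), by
    have h := (hf.tendsto 0).comp (show Tendsto r.1 cofinite (𝓝 0) from r.2)
    rw [map_zero] at h
    exact h⟩
  map_zero' := by ext x; simp
  map_add' r s := by ext x; simp

section RightLinear

/- `R` is a complete, separated topological ring in which open right ideals
(`Rᵐᵒᵖ`-submodules of `R`) form a base of neighbourhoods of zero. -/
variable {R : Type u} [Ring R] [UniformSpace R] [IsUniformAddGroup R] [IsTopologicalRing R]
  [CompleteSpace R] [T2Space R] [IsLinearTopology Rᵐᵒᵖ R]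

theorem nonarchimedean_of_rightLinear (R : Type u) [Ring R] [UniformSpace R]
    [IsUniformAddGroup R] [IsLinearTopology Rᵐᵒᵖ R] : NonarchimedeanAddGroup R where
  is_nonarchimedean U hU := by
    obtain ⟨I, hI, hIU⟩ := (IsLinearTopology.hasBasis_open_submodule (M := R) Rᵐᵒᵖ).mem_iff.1 hU
    exact ⟨⟨I.toAddSubgroup, hI⟩, hIU⟩

theorem summable_of_tendsto {X : Type v} {a : X → R} (ha : Tendsto a cofinite (𝓝 0)) :
    Summable a :=
  have := nonarchimedean_of_rightLinear R
  NonarchimedeanAddGroup.summable_of_tendsto_cofinite_zero ha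

theorem tendsto_of_rightIdeals {X : Type v} {a : X → R}
    (h : ∀ I : Submodule Rᵐᵒᵖ R, IsOpen (I : Set R) → {x | a x ∉ I}.Finite) :
    Tendsto a cofinite (𝓝 0) := by
  rw [(IsLinearTopology.hasBasis_open_submodule (M := R) Rᵐᵒᵖ).tendsto_right_iff]
  intro I hI
  exact h I hI

theorem finite_of_tendsto {X : Type v} {a : X → R} (ha : Tendsto a cofinite (𝓝 0))
    (I : Submodule Rᵐᵒᵖ R) (hI : IsOpen (I : Set R)) : {x | a x ∉ I}.Finite :=
  ha (hI.mem_nhds I.zero_mem)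

theorem tsum_mem_rightIdeal {X : Type v} {a : X → R} (I : Submodule Rᵐᵒᵖ R)
    (hI : IsOpen (I : Set R)) (h : ∀ x, a x ∈ I) : ∑' x, a x ∈ I :=
  tsum_mem (I.toAddSubgroup.isClosed_of_isOpen hI) h

theorem tendsto_fiber {X : Type v} (r : FormalSum R X) (S : Set X) :
    Tendsto (fun x : S => r.1 x) cofinite (𝓝 0) :=
  Tendsto.comp (show Tendsto r.1 cofinite (𝓝 0) from r.2)
    Subtype.val_injective.tendsto_cofinite

theorem tendsto_join {X : Type v} (r : FormalSum R (FormalSum R X)) (x : X) :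
    Tendsto (fun y : FormalSum R X => r.1 y * y.1 x) cofinite (𝓝 0) :=
  IsLinearTopology.tendsto_mul_zero_of_left r.1 (fun y => y.1 x) r.2

/-- The map `R[[f]] : R[[X]] → R[[Y]]` induced by a map of sets `f : X → Y`, taking `∑ rₓ x` to
`∑_y (∑_{f x = y} rₓ) y`, where the inner sums are limits of finite partial sums. -/
noncomputable def map {X : Type v} {Y : Type w} (f : X → Y) :
    FormalSum R X →+ FormalSum R Y where
  toFun r := ⟨fun y => ∑' x : f ⁻¹' {y}, r.1 x, by
    refine tendsto_of_rightIdeals fun I hI => ?_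
    refine ((finite_of_tendsto r.2 I hI).image f).subset fun y hy => ?_
    by_contra hc
    refine hy (tsum_mem_rightIdeal I hI fun x => ?_)
    by_contra hx
    exact hc ⟨x.1, hx, x.2⟩⟩
  map_zero' := by ext y; simp
  map_add' r s := by
    ext y
    exact (summable_of_tendsto (tendsto_fiber r _)).tsum_add
      (summable_of_tendsto (tendsto_fiber s _))

open Classical in
/-- The monad unit `X → R[[X]]`: the element `x₀` goes to the formal linear combination with
coefficient `1` at `x₀` and `0` elsewhere. -/
noncomputable def point {X : Type v} (x₀ : X) : FormalSum R X :=
  ⟨fun x => if x = x₀ then 1 else 0, by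
    refine tendsto_of_rightIdeals fun I _ => (Set.finite_singleton x₀).subset fun x hx => ?_
    by_contra hc
    exact hx (by simp [show x ≠ x₀ from hc])⟩

/-- The monad multiplication `R[[R[[X]]]] → R[[X]]` ("opening of parentheses"): it takes
`∑_y r_y y`, where `y = ∑ₓ s_{y,x} x` runs over `R[[X]]`, to `∑ₓ (∑_y r_y s_{y,x}) x`. -/
noncomputable def join {X : Type v} : FormalSum R (FormalSum R X) →+ FormalSum R X where
  toFun r := ⟨fun x => ∑' y : FormalSum R X, r.1 y * y.1 x, by
    refine tendsto_of_rightIdeals fun I hI => ?_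
    have hfin : ∀ y : FormalSum R X, {x | r.1 y * y.1 x ∉ I}.Finite := fun y => by
      refine finite_of_tendsto ?_ I hI
      have h := Tendsto.const_mul (r.1 y) (show Tendsto y.1 cofinite (𝓝 0) from y.2)
      rw [mul_zero] at h
      exact h
    refine ((finite_of_tendsto r.2 I hI).biUnion fun y _ => hfin y).subset fun x hx => ?_
    by_contra hc
    simp only [Set.mem_iUnion, not_exists, Set.mem_ofPred_eq, not_not] at hc
    refine hx (tsum_mem_rightIdeal I hI fun y => ?_)
    by_cases hy : r.1 y ∈ I
    · exact I.smul_mem (MulOpposite.op (y.1 x)) hy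
    · exact hc y hy⟩
  map_zero' := by ext x; simp
  map_add' r s := by
    ext x
    refine Eq.trans ?_ ((summable_of_tendsto (tendsto_join r x)).tsum_add
      (summable_of_tendsto (tendsto_join s x)))
    exact tsum_congr fun y => add_mul _ _ _

theorem point_self {X : Type v} (x₀ : X) : (point x₀ : FormalSum R X).1 x₀ = 1 :=
  if_pos rfl

theorem point_of_ne {X : Type v} {x₀ x : X} (h : x ≠ x₀) : (point x₀ : FormalSum R X).1 x = 0 :=
  if_neg h

theorem map_point {X : Type v} {Y : Type w} (f : X → Y) (x : X) :
    map f (point x : FormalSum R X) = point (f x) := by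
  ext y
  change ∑' z : f ⁻¹' {y}, (point x : FormalSum R X).1 z = (point (f x) : FormalSum R Y).1 y
  by_cases h : y = f x
  · subst h
    rw [tsum_eq_single ⟨x, rfl⟩, point_self, point_self]
    intro z hz
    exact point_of_ne fun hzx => hz (Subtype.ext hzx)
  · rw [point_of_ne h]
    refine (tsum_congr fun z => point_of_ne fun hzx => h ?_).trans tsum_zero
    rw [← hzx]
    exact z.2.symm

theorem join_point {X : Type v} (r : FormalSum R X) : join (point r) = r := by
  ext x
  change ∑' y : FormalSum R X, (point r : FormalSum R (FormalSum R X)).1 y * y.1 x = r.1 x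
  rw [tsum_eq_single r, point_self, one_mul]
  intro y hy
  rw [point_of_ne hy, zero_mul]

theorem map_id {X : Type v} (r : FormalSum R X) : map id r = r := by
  ext x
  change ∑' z : (id : X → X) ⁻¹' {x}, r.1 z = r.1 x
  rw [tsum_eq_single ⟨x, rfl⟩]
  intro z hz
  exact absurd (Subtype.ext (show z.1 = x from z.2)) hz

theorem map_comp {X Y Z : Type v} (f : X → Y) (g : Y → Z) (r : FormalSum R X) :
    map (g ∘ f) r = map g (map f r) := by
  ext z
  have hs : Summable fun x : (g ∘ f) ⁻¹' {z} => r.1 x := summable_of_tendsto (tendsto_fiber r _)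
  let e : (Σ y : g ⁻¹' {z}, f ⁻¹' {y.1}) ≃ ((g ∘ f) ⁻¹' {z} : Set X) :=
    { toFun := fun p => ⟨p.2.1, by
        have h1 : f p.2.1 = p.1.1 := p.2.2
        have h2 : g p.1.1 = z := p.1.2
        change g (f p.2.1) = z
        rw [h1, h2]⟩
      invFun := fun x => ⟨⟨f x.1, x.2⟩, ⟨x.1, rfl⟩⟩
      left_inv := by
        rintro ⟨⟨y, hy⟩, ⟨x, hx⟩⟩
        obtain rfl : f x = y := hx
        rfl
      right_inv := fun x => rfl }
  change ∑' x : (g ∘ f) ⁻¹' {z}, r.1 x = ∑' y : g ⁻¹' {z}, ∑' x : f ⁻¹' {y.1}, r.1 x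
  rw [← e.tsum_eq]
  exact ((e.summable_iff (f := fun x : (g ∘ f) ⁻¹' {z} => r.1 x)).2 hs).tsum_sigma

end RightLinear

end FormalSum

/-! ### Left contramodules -/

section Contramodules

/-- A left contramodule over `R`: an algebra over the monad `X ↦ R[[X]]` on the category of sets,
that is, a set with a contraaction map `R[[C]] → C` satisfying contraunitality and
contraassociativity. -/
structure Contramodule (R : Type u) [Ring R] [UniformSpace R] [IsUniformAddGroup R]
    [IsTopologicalRing R] [CompleteSpace R] [T2Space R] [IsLinearTopology Rᵐᵒᵖ R] where
  /-- the underlying set -/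
  carrier : Type u
  /-- the left contraaction map -/
  act : FormalSum R carrier → carrier
  act_point : ∀ c : carrier, act (FormalSum.point c) = c
  act_assoc : ∀ r : FormalSum R (FormalSum R carrier),
    act (FormalSum.map act r) = act (FormalSum.join r)

variable {R : Type u} [Ring R] [UniformSpace R] [IsUniformAddGroup R] [IsTopologicalRing R]
  [CompleteSpace R] [T2Space R] [IsLinearTopology Rᵐᵒᵖ R]

namespace Contramodule

/-- A morphism of left contramodules: a map of sets commuting with the contraactions. -/
@[ext]
structure Hom (C D : Contramodule R) where
  /-- the underlying map of sets -/
  toFun : C.carrier → D.carrier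
  map_act : ∀ r : FormalSum R C.carrier, toFun (C.act r) = D.act (FormalSum.map toFun r)

/-- The category of left contramodules over `R`. -/
instance : Category (Contramodule R) where
  Hom C D := Hom C D
  id C := ⟨id, fun r => by rw [FormalSum.map_id]; rfl⟩
  comp f g := ⟨g.toFun ∘ f.toFun, fun r => by
    rw [FormalSum.map_comp, ← g.map_act, ← f.map_act]; rfl⟩

/- The underlying abelian group of a left contramodule: `a + b` is the contraaction applied to the
finite formal linear combination `1 a + 1 b`, and similarly for `0` and `-a`. -/

noncomputable instance (C : Contramodule R) : Zero C.carrier := ⟨C.act 0⟩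

noncomputable instance (C : Contramodule R) : Add C.carrier :=
  ⟨fun a b => C.act (FormalSum.point a + FormalSum.point b)⟩

noncomputable instance (C : Contramodule R) : Neg C.carrier :=
  ⟨fun a => C.act (-FormalSum.point a)⟩

theorem act_add (C : Contramodule R) (r s : FormalSum R C.carrier) :
    C.act (r + s) = C.act r + C.act s := by
  have h := C.act_assoc (FormalSum.point r + FormalSum.point s)
  rw [_root_.map_add, _root_.map_add, FormalSum.map_point, FormalSum.map_point,
    FormalSum.join_point, FormalSum.join_point] at h
  exact h.symm

theorem act_neg (C : Contramodule R) (r : FormalSum R C.carrier) : C.act (-r) = -C.act r := by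
  have h := C.act_assoc (-FormalSum.point r)
  rw [_root_.map_neg, _root_.map_neg, FormalSum.map_point, FormalSum.join_point] at h
  exact h.symm

theorem act_surjective (C : Contramodule R) : Function.Surjective C.act :=
  fun c => ⟨FormalSum.point c, C.act_point c⟩

/-- The underlying abelian group structure of a left contramodule. -/
noncomputable instance (C : Contramodule R) : AddCommGroup C.carrier where
  add_assoc a b c := by
    obtain ⟨r, rfl⟩ := C.act_surjective a
    obtain ⟨s, rfl⟩ := C.act_surjective b
    obtain ⟨t, rfl⟩ := C.act_surjective c
    rw [← act_add, ← act_add, ← act_add, ← act_add, add_assoc]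
  zero_add a := by
    obtain ⟨r, rfl⟩ := C.act_surjective a
    change C.act 0 + _ = _
    rw [← act_add, zero_add]
  add_zero a := by
    obtain ⟨r, rfl⟩ := C.act_surjective a
    change _ + C.act 0 = _
    rw [← act_add, add_zero]
  neg_add_cancel a := by
    obtain ⟨r, rfl⟩ := C.act_surjective a
    rw [← act_neg, ← act_add, neg_add_cancel]
    rfl
  add_comm a b := by
    obtain ⟨r, rfl⟩ := C.act_surjective a
    obtain ⟨s, rfl⟩ := C.act_surjective b
    rw [← act_add, ← act_add, add_comm]
  nsmul := nsmulRec
  zsmul := zsmulRec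

end Contramodule

end Contramodules

/-! ### Discrete right modules and the contratensor product -/

/-- A right `R`-module `N` (a module over `Rᵐᵒᵖ`) is discrete if the annihilator in `R` of each of
its elements is open. -/
class IsDiscreteRightModule (R : Type u) [Ring R] [TopologicalSpace R] (N : Type v)
    [AddCommGroup N] [Module Rᵐᵒᵖ N] : Prop where
  isOpen_annihilator : ∀ b : N, IsOpen {r : R | MulOpposite.op r • b = 0}

section Contratensor

variable {R : Type u} [Ring R] [UniformSpace R] [IsUniformAddGroup R] [IsTopologicalRing R]
  [CompleteSpace R] [T2Space R] [IsLinearTopology Rᵐᵒᵖ R]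

/-- For an element `b` of a discrete right `R`-module `N` and `r = ∑ rₓ x` in `R[[X]]`, the finite
formal linear combination `∑ (b rₓ) x` in `N[X]`. -/
noncomputable def FormalSum.smulLeft {N : Type v} [AddCommGroup N] [Module Rᵐᵒᵖ N]
    [IsDiscreteRightModule R N] {X : Type w} (b : N) (r : FormalSum R X) : X →₀ N :=
  Finsupp.ofSupportFinite (fun x => MulOpposite.op (r.1 x) • b) <|
    (show Tendsto r.1 cofinite (𝓝 0) from r.2)
      ((IsDiscreteRightModule.isOpen_annihilator (R := R) b).mem_nhds (by simp))

namespace Contratensor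

/-- The image of the difference of the two homomorphisms `N ⊗ R[[C]] ⇉ N ⊗ C` defining the
contratensor product: it is generated by the differences of the images of the pure tensors
`b ⊗ r`, namely `b ⊗ π(r)` and `∑_c (b r_c) ⊗ c` for `r = ∑_c r_c c`. -/
noncomputable def relations (N : Type v) [AddCommGroup N] [Module Rᵐᵒᵖ N]
    [IsDiscreteRightModule R N] (C : Contramodule R) : AddSubgroup (N ⊗[ℤ] C.carrier) :=
  AddSubgroup.closure (Set.range fun p : N × FormalSum R C.carrier =>
    p.1 ⊗ₜ[ℤ] C.act p.2 - (FormalSum.smulLeft p.1 p.2).sum fun c n => n ⊗ₜ[ℤ] c)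

end Contratensor

/-- The contratensor product of a discrete right `R`-module `N` and a left `R`-contramodule `C`:
the cokernel of the difference of the natural pair of homomorphisms `N ⊗ R[[C]] ⇉ N ⊗ C`. -/
abbrev Contratensor (N : Type v) [AddCommGroup N] [Module Rᵐᵒᵖ N]
    [IsDiscreteRightModule R N] (C : Contramodule R) : Type (max u v) :=
  (N ⊗[ℤ] C.carrier) ⧸ Contratensor.relations N C

/-- The homomorphism of contratensor products induced by a homomorphism of discrete right
`R`-modules. -/
noncomputable def Contratensor.map {N : Type v} [AddCommGroup N] [Module Rᵐᵒᵖ N]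
    [IsDiscreteRightModule R N] {N' : Type w} [AddCommGroup N'] [Module Rᵐᵒᵖ N']
    [IsDiscreteRightModule R N'] (f : N →ₗ[Rᵐᵒᵖ] N') (C : Contramodule R) :
    Contratensor N C →+ Contratensor N' C :=
  QuotientAddGroup.map (Contratensor.relations N C) (Contratensor.relations N' C)
    (TensorProduct.map f.toAddMonoidHom.toIntLinearMap
      (LinearMap.id : C.carrier →ₗ[ℤ] C.carrier)).toAddMonoidHom <| by
    rw [Contratensor.relations, AddSubgroup.closure_le]
    rintro _ ⟨⟨b, r⟩, rfl⟩
    refine AddSubgroup.subset_closure ⟨(f b, r), ?_⟩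
    have h : FormalSum.smulLeft (f b) r
        = (FormalSum.smulLeft b r).mapRange f (_root_.map_zero f) := by
      ext x
      exact (f.map_smul _ _).symm
    simp only [h, LinearMap.toAddMonoidHom_coe, _root_.map_sub, TensorProduct.map_tmul]
    rw [Finsupp.sum_mapRange_index (by simp), Finsupp.sum, Finsupp.sum, _root_.map_sum]
    rfl

/-- A left `R`-contramodule `F` is flat if the functor of contratensor product with `F` is exact
on the abelian category of discrete right `R`-modules. -/
def Contramodule.Flat (F : Contramodule R) : Prop :=
  ∀ (N₁ N₂ N₃ : Type u) [AddCommGroup N₁] [AddCommGroup N₂] [AddCommGroup N₃]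
    [Module Rᵐᵒᵖ N₁] [Module Rᵐᵒᵖ N₂] [Module Rᵐᵒᵖ N₃]
    [IsDiscreteRightModule R N₁] [IsDiscreteRightModule R N₂] [IsDiscreteRightModule R N₃]
    (f : N₁ →ₗ[Rᵐᵒᵖ] N₂) (g : N₂ →ₗ[Rᵐᵒᵖ] N₃),
    Function.Injective f → Function.Exact f g → Function.Surjective g →
      Function.Injective (Contratensor.map f F) ∧
      Function.Exact (Contratensor.map f F) (Contratensor.map g F) ∧
      Function.Surjective (Contratensor.map g F)

end Contratensor

/-! ### Conditions on an ideal -/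

/-- An ideal `H` of a (complete, separated) topological ring is strongly closed if it is closed, the
topological quotient group `R ⧸ H` is complete, and for every set `X` the induced map
`R[[X]] → (R ⧸ H)[[X]]` is surjective. -/
structure IsStronglyClosed {R : Type u} [Ring R] [TopologicalSpace R] [IsTopologicalRing R]
    (H : Ideal R) : Prop where
  isClosed : IsClosed (H : Set R)
  complete : @CompleteSpace (R ⧸ H) (IsTopologicalAddGroup.rightUniformSpace (R ⧸ H))
  surjective : ∀ X : Type u, Function.Surjective
    (FormalSum.mapCoeff (A := R) (B := R ⧸ H) H.mkQ.toAddMonoidHom H.continuous_mkQ X)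

/-- An ideal `H` is topologically left T-nilpotent if for any sequence `a₀, a₁, a₂, …` in `H` the
sequence of products `a₀, a₀ a₁, a₀ a₁ a₂, …` converges to zero. -/
def IsTopLeftTNilpotent {R : Type u} [Ring R] [TopologicalSpace R] (H : Ideal R) : Prop :=
  ∀ a : ℕ → R, (∀ n, a n ∈ H) →
    Tendsto (fun n => ((List.range (n + 1)).map a).prod) atTop (𝓝 0)

/-!
By topological nilpotence of `H`, primitive idempotents of the semisimple factors of `R ⧸ H` lift to
idempotents `e x` of `R`, and `F` has elements `f x = e x • f x` that generate it modulo `H F` and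
on which coordinates with values in `R ⧸ H` are available. The Nakayama lemma for contramodules,
the other consequence of T-nilpotence, then shows that every element of `F` is an infinite linear
combination `∑ rₓ f(x)` with `rₓ e(x) = rₓ`.

For flat `F` such a combination is unique. If `∑ rₓ f(x) = 0` had a nonzero coefficient, then for
some open right ideal `I` the images of the `rₓ` would span a nonzero submodule of the discrete
right module `R ⧸ I`. It is finitely generated, hence has a simple quotient. A simple discrete right
module is killed by `H`, so in its contratensor product with `F` the coordinates separate the
coefficients, and flatness allows the relation to be tested there. Uniqueness splits the surjection
`R[[X]] → F`, so `F` is a retract of a free contramodule.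
-/

namespace FormalSum

section Coefficients

variable {A : Type*} [AddCommGroup A] [TopologicalSpace A] [IsTopologicalAddGroup A] {X : Type*}

theorem ext_apply {r s : FormalSum A X} (h : ∀ x, r.1 x = s.1 x) : r = s :=
  Subtype.ext (funext h)

theorem finite_notMem (r : FormalSum A X) {V : AddSubgroup A} (hV : IsOpen (V : Set A)) :
    {x | r.1 x ∉ V}.Finite :=
  (show Tendsto r.1 cofinite (𝓝 0) from r.2) (hV.mem_nhds V.zero_mem)

/-- The inclusion `A[X] → A[[X]]` of the finite formal linear combinations. -/
def ofFinsupp : (X →₀ A) →+ FormalSum A X where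
  toFun t := ⟨t, tendsto_nhds_of_eventually_eq t.hasFiniteSupport⟩
  map_zero' := rfl
  map_add' _ _ := rfl

/-- The formal linear combination `a x`. -/
noncomputable def single (a : A) (x : X) : FormalSum A X :=
  ofFinsupp (Finsupp.single x a)

theorem single_self (a : A) (x : X) : (single a x).1 x = a :=
  Finsupp.single_eq_same

theorem single_of_ne (a : A) {x y : X} (h : y ≠ x) : (single a x).1 y = 0 :=
  Finsupp.single_eq_of_ne h

theorem single_zero (x : X) : single (0 : A) x = 0 := by
  rw [single, Finsupp.single_zero, map_zero]

theorem single_add (a b : A) (x : X) : single (a + b) x = single a x + single b x := by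
  rw [single, Finsupp.single_add, map_add, single, single]

theorem mul_single_apply {R : Type*} [Ring R] [TopologicalSpace R] [IsTopologicalRing R]
    (a b : R) (x y : X) : a * (single b x).1 y = (single (a * b) x).1 y := by
  rcases eq_or_ne y x with rfl | h
  · rw [single_self, single_self]
  · rw [single_of_ne _ h, single_of_ne _ h, mul_zero]

/-- The subgroup of `A[[X]]` formed by the combinations with all coefficients in `V`. -/
def coeffIn (V : AddSubgroup A) (X : Type*) : AddSubgroup (FormalSum A X) where
  carrier := {r | ∀ x, r.1 x ∈ V}
  zero_mem' _ := V.zero_mem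
  add_mem' hr hs x := V.add_mem (hr x) (hs x)
  neg_mem' hr x := V.neg_mem (hr x)

theorem single_mem_coeffIn {V : AddSubgroup A} {a : A} (ha : a ∈ V) (x : X) :
    single a x ∈ coeffIn V X := fun y => by
  rcases eq_or_ne y x with rfl | h
  · rwa [single_self]
  · rw [single_of_ne a h]
    exact V.zero_mem

theorem exists_sub_sum_single_mem_coeffIn (r : FormalSum A X) {V : AddSubgroup A}
    (hV : IsOpen (V : Set A)) :
    ∃ T : Finset X, r - ∑ x ∈ T, single (r.1 x) x ∈ coeffIn V X := by
  refine ⟨(finite_notMem r hV).toFinset, fun z => ?_⟩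
  change r.1 z - (∑ x ∈ _, single (r.1 x) x).1 z ∈ V
  rw [AddSubgroup.val_finsetSum, Finset.sum_apply]
  by_cases hz : r.1 z ∈ V
  · rw [Finset.sum_eq_zero, sub_zero]
    · exact hz
    · refine fun x hx => single_of_ne _ fun h => ?_
      exact (finite_notMem r hV).mem_toFinset.1 hx (h ▸ hz)
  · rw [Finset.sum_eq_single z (fun x _ hx => single_of_ne _ hx.symm), single_self, sub_self]
    · exact V.zero_mem
    · exact fun h => (h ((finite_notMem r hV).mem_toFinset.2 hz)).elim

theorem mem_of_single_mem {W : AddSubgroup (FormalSum A X)} {V : AddSubgroup A}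
    (hV : IsOpen (V : Set A)) (hVW : coeffIn V X ≤ W) {r : FormalSum A X}
    (h : ∀ x, single (r.1 x) x ∈ W) : r ∈ W := by
  obtain ⟨T, hT⟩ := exists_sub_sum_single_mem_coeffIn r hV
  rw [← sub_add_cancel r (∑ x ∈ T, single (r.1 x) x)]
  exact W.add_mem (hVW hT) (W.sum_mem fun x _ => h x)

theorem hom_ext_of_isOpen {B : Type*} [AddCommGroup B] {f g : FormalSum A X →+ B}
    {V : AddSubgroup A} (hV : IsOpen (V : Set A)) (hfg : ∀ r ∈ coeffIn V X, f r = g r)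
    (h : ∀ a x, f (single a x) = g (single a x)) : f = g :=
  AddMonoidHom.ext fun r => mem_of_single_mem (W := f.eqLocus g) hV hfg fun x => h (r.1 x) x

end Coefficients

section Kleisli

variable {R : Type u} [Ring R] [UniformSpace R] [IsUniformAddGroup R] [IsTopologicalRing R]
  [CompleteSpace R] [T2Space R] [IsLinearTopology Rᵐᵒᵖ R] {X Y Z : Type*}

theorem single_one (x : X) : single (1 : R) x = point x := by
  refine ext_apply fun y => ?_
  rcases eq_or_ne y x with rfl | h
  · rw [single_self, point_self]
  · rw [single_of_ne _ h, point_of_ne h]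

/-- The Kleisli extension `∑ rₓ x ↦ ∑ rₓ G(x)` of a map `G : X → R[[Y]]`. -/
noncomputable def kleisli (G : X → FormalSum R Y) : FormalSum R X →+ FormalSum R Y :=
  join.comp (map G)

theorem summable_kleisli (G : X → FormalSum R Y) (r : FormalSum R X) (y : Y) :
    Summable fun x => r.1 x * (G x).1 y :=
  summable_of_tendsto <|
    IsLinearTopology.tendsto_mul_zero_of_left r.1 (fun x => (G x).1 y) r.2

theorem kleisli_apply (G : X → FormalSum R Y) (r : FormalSum R X) (y : Y) :
    (kleisli G r).1 y = ∑' x, r.1 x * (G x).1 y := by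
  have hs := (Equiv.sigmaFiberEquiv G).summable_iff.2 (summable_kleisli G r y)
  change ∑' s : FormalSum R Y, (∑' x : G ⁻¹' {s}, r.1 x) * s.1 y = _
  rw [← (Equiv.sigmaFiberEquiv G).tsum_eq]
  refine Eq.trans (tsum_congr fun s => ?_) hs.tsum_sigma.symm
  rw [← (summable_of_tendsto (tendsto_fiber r (G ⁻¹' {s}))).tsum_mul_right]
  refine tsum_congr ?_
  rintro ⟨x, rfl⟩
  rfl

theorem kleisli_single_apply (G : X → FormalSum R Y) (a : R) (x : X) (y : Y) :
    (kleisli G (single a x)).1 y = a * (G x).1 y := by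
  rw [kleisli_apply, tsum_eq_single x, single_self]
  intro z hz
  rw [single_of_ne a hz, zero_mul]

theorem kleisli_point (G : X → FormalSum R Y) (x : X) : kleisli G (point x) = G x := by
  rw [kleisli, AddMonoidHom.comp_apply, map_point, join_point]

theorem join_eq_kleisli (r : FormalSum R (FormalSum R X)) : join r = kleisli id r := by
  rw [kleisli, AddMonoidHom.comp_apply, map_id]

theorem map_eq_kleisli (f : X → Y) (r : FormalSum R X) :
    map f r = kleisli (fun x => point (f x)) r := by
  refine ext_apply fun y => ?_
  rw [kleisli_apply]
  change ∑' x : f ⁻¹' {y}, r.1 x = _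
  rw [tsum_subtype (f ⁻¹' {y}) r.1]
  refine tsum_congr fun x => ?_
  by_cases h : f x = y
  · rw [Set.indicator_of_mem (by exact h), ← h, point_self, mul_one]
  · rw [Set.indicator_of_notMem (by exact h), point_of_ne (Ne.symm h), mul_zero]

theorem kleisli_point_eq_self (r : FormalSum R X) : kleisli point r = r :=
  (map_eq_kleisli id r).symm.trans (map_id r)

theorem summable_kleisli_prod (r : FormalSum R X) (G : X → FormalSum R Y) (c : Y → R) :
    Summable fun p : X × Y => r.1 p.1 * (G p.1).1 p.2 * c p.2 := by
  refine summable_of_tendsto (IsLinearTopology.tendsto_mul_zero_of_left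
    (fun p : X × Y => r.1 p.1 * (G p.1).1 p.2) _ (tendsto_of_rightIdeals fun I hI => ?_))
  have hG (x : X) : {y | r.1 x * (G x).1 y ∉ I}.Finite := by
    have h := Tendsto.const_mul (r.1 x) (show Tendsto (G x).1 cofinite (𝓝 0) from (G x).2)
    rw [mul_zero] at h
    exact finite_of_tendsto h I hI
  refine ((finite_of_tendsto r.2 I hI).biUnion fun x _ =>
    (hG x).image (Prod.mk x)).subset fun p hp => ?_
  simp only [Set.mem_iUnion]
  exact ⟨p.1, fun h => hp (I.smul_mem (MulOpposite.op ((G p.1).1 p.2)) h), p.2, hp, rfl⟩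

theorem kleisli_kleisli (G : X → FormalSum R Y) (K : Y → FormalSum R Z) (r : FormalSum R X) :
    kleisli K (kleisli G r) = kleisli (fun x => kleisli K (G x)) r := by
  refine ext_apply fun z => ?_
  calc (kleisli K (kleisli G r)).1 z
      = ∑' y, ∑' x, r.1 x * (G x).1 y * (K y).1 z := by
        simp only [kleisli_apply, (summable_kleisli G r _).tsum_mul_right]
    _ = ∑' x, ∑' y, r.1 x * (G x).1 y * (K y).1 z :=
        (summable_kleisli_prod r G fun y => (K y).1 z).tsum_comm
    _ = (kleisli (fun x => kleisli K (G x)) r).1 z := by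
        simp only [kleisli_apply, mul_assoc, (summable_kleisli K (G _) z).tsum_mul_left]

theorem map_kleisli (f : Y → Z) (G : X → FormalSum R Y) (r : FormalSum R X) :
    map f (kleisli G r) = kleisli (fun x => map f (G x)) r := by
  simp only [map_eq_kleisli, kleisli_kleisli]

theorem map_map (f : X → Y) (g : Y → Z) (r : FormalSum R X) : map g (map f r) = map (g ∘ f) r := by
  rw [map_eq_kleisli f, map_kleisli, map_eq_kleisli (g ∘ f)]
  simp only [map_point, Function.comp_apply]

theorem kleisli_add_left (G K : X → FormalSum R Y) (r : FormalSum R X) :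
    kleisli (G + K) r = kleisli G r + kleisli K r := by
  refine ext_apply fun y => ?_
  change _ = (kleisli G r).1 y + (kleisli K r).1 y
  simp only [kleisli_apply, ← (summable_kleisli G r y).tsum_add (summable_kleisli K r y), ← mul_add]
  rfl

theorem map_single (f : X → Y) (a : R) (x : X) : map f (single a x) = single a (f x) := by
  refine ext_apply fun y => ?_
  rw [map_eq_kleisli, kleisli_single_apply, ← single_one, mul_single_apply, mul_one]

theorem map_const (y : Y) (r : FormalSum R X) : map (fun _ => y) r = single (∑' x, r.1 x) y := by
  refine ext_apply fun z => ?_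
  rw [map_eq_kleisli, kleisli_apply, (summable_of_tendsto r.2).tsum_mul_right, ← single_one,
    mul_single_apply, mul_one]

theorem join_single_single (a b : R) (x : X) : join (single a (single b x)) = single (a * b) x := by
  refine ext_apply fun y => ?_
  rw [join_eq_kleisli, kleisli_single_apply, id, mul_single_apply]

/-- Multiplication of the coefficients on the right by a family of elements of the ring. -/
noncomputable def mulRight (a : X → R) : FormalSum R X →+ FormalSum R X :=
  kleisli fun x => single (a x) x

theorem mulRight_apply (a : X → R) (r : FormalSum R X) (x : X) :
    (mulRight a r).1 x = r.1 x * a x := by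
  rw [mulRight, kleisli_apply, tsum_eq_single x, single_self]
  intro z hz
  rw [single_of_ne _ hz.symm, mul_zero]

theorem map_mem_coeffIn {V : AddSubgroup R} (hV : IsClosed (V : Set R)) (f : X → Y)
    {r : FormalSum R X} (hr : r ∈ coeffIn V X) : map f r ∈ coeffIn V Y :=
  fun y => tsum_mem hV fun x : f ⁻¹' {y} => hr x

theorem kleisli_mem_coeffIn (I : Submodule Rᵐᵒᵖ R) (hI : IsOpen (I : Set R))
    (G : X → FormalSum R Y) {r : FormalSum R X} (hr : r ∈ coeffIn I.toAddSubgroup X) :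
    kleisli G r ∈ coeffIn I.toAddSubgroup Y := fun y => by
  rw [kleisli_apply]
  exact tsum_mem_rightIdeal I hI fun x => I.smul_mem (MulOpposite.op _) (hr x)

end Kleisli

end FormalSum

theorem IsTopLeftTNilpotent.zero_mem_closure {R : Type u} [Ring R] [TopologicalSpace R]
    {H : Ideal R} (hT : IsTopLeftTNilpotent H) {S : Set R} (h1 : 1 ∈ S)
    (hS : ∀ a ∈ S, ∃ h ∈ H, a * h ∈ S) : 0 ∈ closure S := by
  choose f hfH hfS using hS
  let p : ℕ → S := fun n => n.rec ⟨1, h1⟩ fun _ a => ⟨a * f a a.2, hfS a a.2⟩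
  have hp (n : ℕ) : ((List.range n).map fun n => f (p n).1 (p n).2).prod =
      (p n).1 := by
    induction n with
    | zero => rfl
    | succ n ih => rw [List.range_succ, List.map_append, List.prod_append, ih, List.map_singleton,
        List.prod_singleton]
  refine mem_closure_of_tendsto (hT _ fun n => hfH (p n).1 (p n).2) (.of_forall fun n => ?_)
  rw [hp]
  exact (p (n + 1)).2

section SmallIterates

variable {A : Type*} [AddCommGroup A] [TopologicalSpace A] [IsTopologicalAddGroup A] {X : Type*}

open FormalSum

/-- For an endomorphism `φ` of `A[[X]]` and an additive subgroup `I` of `A`, the subgroup of all `v`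
such that all but finitely many of the coefficients of all the iterates `φⁿ(v)` lie in `I`. -/
def smallIterates (φ : FormalSum A X →+ FormalSum A X) (I : AddSubgroup A) :
    AddSubgroup (FormalSum A X) where
  carrier := {v | {p : ℕ × X | (φ^[p.1] v).1 p.2 ∉ I}.Finite}
  zero_mem' := by simp [iterate_map_zero]
  add_mem' {v w} hv hw := (hv.union hw).subset fun p hp => by
    by_contra h
    simp only [Set.mem_union, Set.mem_ofPred_eq, not_or, not_not] at h
    refine hp ?_
    rw [iterate_map_add]
    exact I.add_mem h.1 h.2
  neg_mem' hv := by simpa [iterate_map_neg] using hv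

theorem mem_smallIterates_of_apply_mem {φ : FormalSum A X →+ FormalSum A X}
    {I : AddSubgroup A} (hI : IsOpen (I : Set A)) {v : FormalSum A X}
    (h : φ v ∈ smallIterates φ I) : v ∈ smallIterates φ I := by
  refine (((finite_notMem v hI).image (Prod.mk 0)).union
    (h.image fun p => (p.1 + 1, p.2))).subset ?_
  rintro ⟨_ | n, x⟩ hp
  · exact Or.inl ⟨x, hp, rfl⟩
  · exact Or.inr ⟨(n, x), hp, rfl⟩

end SmallIterates

section GeometricSeries

variable {R : Type u} [Ring R] [UniformSpace R] [IsUniformAddGroup R] [IsTopologicalRing R]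
  [CompleteSpace R] [T2Space R] [IsLinearTopology Rᵐᵒᵖ R] {X : Type*}

open FormalSum

theorem coeffIn_le_smallIterates (s : X → FormalSum R X) (I : Submodule Rᵐᵒᵖ R)
    (hI : IsOpen (I : Set R)) :
    coeffIn I.toAddSubgroup X ≤ smallIterates (kleisli s) I.toAddSubgroup := fun v hv => by
  have h (n : ℕ) : (kleisli s)^[n] v ∈ coeffIn I.toAddSubgroup X := by
    induction n with
    | zero => exact hv
    | succ n ih =>
      rw [Function.iterate_succ_apply']
      exact kleisli_mem_coeffIn I hI s ih
  exact Set.finite_empty.subset fun p hp => hp (h p.1 p.2)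

variable {H : Ideal R} (hT : IsTopLeftTNilpotent H) {s : X → FormalSum R X}
  (hs : ∀ x, s x ∈ coeffIn H.toAddSubgroup X)

include hT hs

theorem IsTopLeftTNilpotent.point_mem_smallIterates (x : X) (I : Submodule Rᵐᵒᵖ R)
    (hI : IsOpen (I : Set R)) :
    point x ∈ smallIterates (kleisli s) I.toAddSubgroup := by
  set W := smallIterates (kleisli s) I.toAddSubgroup
  have hIW : coeffIn I.toAddSubgroup X ≤ W := coeffIn_le_smallIterates s I hI
  by_contra hx
  have h0 : (0 : R) ∈ closure {a | ∃ y, single a y ∉ W} := by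
    refine hT.zero_mem_closure ⟨x, by rwa [single_one]⟩ ?_
    rintro a ⟨y, hy⟩
    have h_iter : kleisli s (single a y) ∉ W := fun h => hy (mem_smallIterates_of_apply_mem hI h)
    obtain ⟨z, hz⟩ : ∃ z, single ((kleisli s (single a y)).1 z) z ∉ W := by
      by_contra! h
      exact h_iter (mem_of_single_mem hI hIW h)
    rw [kleisli_single_apply] at hz
    exact ⟨(s y).1 z, hs y z, z, hz⟩
  obtain ⟨a, haI, y, hy⟩ := mem_closure_iff.1 h0 I hI I.zero_mem
  exact hy (hIW (single_mem_coeffIn haI y))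

/- The solution is `∑ₙ (kleisli s)ⁿ (point x)`. -/
theorem IsTopLeftTNilpotent.exists_eq_point_add_kleisli (x : X) :
    ∃ t : FormalSum R X, t = point x + kleisli s t := by
  let row (n : ℕ) : FormalSum R X := (kleisli s)^[n] (point x)
  let T : FormalSum R (ℕ × X) := ⟨fun p => (row p.1).1 p.2,
    tendsto_of_rightIdeals fun I hI => hT.point_mem_smallIterates hs x I hI⟩
  have hsum (G : X → FormalSum R X) (y : X) :
      HasSum (fun n => (kleisli G (row n)).1 y) ((kleisli (fun p : ℕ × X => G p.2) T).1 y) := by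
    have h := summable_kleisli (fun p : ℕ × X => G p.2) T y
    simp only [kleisli_apply]
    exact h.hasSum.prod_fiberwise fun n => (h.prod_factor n).hasSum
  have hT_point : map Prod.snd T = kleisli (fun p : ℕ × X => point p.2) T := map_eq_kleisli _ T
  have hT_s : kleisli s (map Prod.snd T) = kleisli (fun p : ℕ × X => s p.2) T := by
    rw [hT_point, kleisli_kleisli]
    simp only [kleisli_point]
  refine ⟨map Prod.snd T, ext_apply fun y => ?_⟩
  have hrow : HasSum (fun n => (row n).1 y) ((map Prod.snd T).1 y) := by
    simpa only [kleisli_point_eq_self, ← hT_point] using hsum point y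
  have hsucc : HasSum (fun n => (row (n + 1)).1 y) ((kleisli s (map Prod.snd T)).1 y) := by
    rw [hT_s]
    simpa only [row, Function.iterate_succ_apply'] using hsum s y
  exact hrow.unique hsucc.zero_add

end GeometricSeries

namespace Contramodule

variable {R : Type u} [Ring R] [UniformSpace R] [IsUniformAddGroup R] [IsTopologicalRing R]
  [CompleteSpace R] [T2Space R] [IsLinearTopology Rᵐᵒᵖ R] {X Y : Type*} {C D : Contramodule R}

open FormalSum

/-- The infinite linear combination `∑ rₓ f(x)` in a contramodule. -/
noncomputable def lin (f : X → C.carrier) : FormalSum R X →+ C.carrier where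
  toFun r := C.act (FormalSum.map f r)
  map_zero' := by rw [map_zero]; rfl
  map_add' r s := by rw [map_add, act_add]

theorem lin_apply (f : X → C.carrier) (r : FormalSum R X) : lin f r = C.act (FormalSum.map f r) :=
  rfl

theorem lin_id (r : FormalSum R C.carrier) : lin id r = C.act r := by
  rw [lin_apply, FormalSum.map_id]

theorem lin_point (f : X → C.carrier) (x : X) : lin f (point x) = f x := by
  rw [lin_apply, map_point, act_point]

theorem lin_map (f : Y → C.carrier) (g : X → Y) (r : FormalSum R X) :
    lin f (FormalSum.map g r) = lin (f ∘ g) r := by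
  rw [lin_apply, lin_apply, FormalSum.map_map]

theorem lin_kleisli (f : Y → C.carrier) (G : X → FormalSum R Y) (r : FormalSum R X) :
    lin f (kleisli G r) = lin (fun x => lin f (G x)) r := by
  rw [lin_apply, map_kleisli, kleisli, AddMonoidHom.comp_apply, ← C.act_assoc, FormalSum.map_map]
  rfl

theorem hom_lin (h : C ⟶ D) (f : X → C.carrier) (r : FormalSum R X) :
    h.toFun (lin f r) = lin (h.toFun ∘ f) r := by
  rw [lin_apply, h.map_act, FormalSum.map_map, ← lin_apply]

theorem lin_add_left (f g : X → C.carrier) (r : FormalSum R X) :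
    lin (f + g) r = lin f r + lin g r := by
  let G : X → FormalSum R C.carrier := (fun x => point (f x)) + fun x => point (g x)
  have hG : (fun x => lin id (G x)) = f + g := by
    funext x
    change lin id (point (f x) + point (g x)) = f x + g x
    rw [map_add, lin_point, lin_point, id, id]
  rw [← hG, ← lin_kleisli, kleisli_add_left, ← map_eq_kleisli, ← map_eq_kleisli, map_add, lin_map,
    lin_map, Function.id_comp, Function.id_comp]

/-- The homomorphism `f ↦ ∑ rₓ f(x)`. -/
noncomputable def linHom (r : FormalSum R X) : (X → C.carrier) →+ C.carrier :=
  AddMonoidHom.mk' (fun f => lin f r) fun f g => lin_add_left f g r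

theorem lin_sub_left (f g : X → C.carrier) (r : FormalSum R X) :
    lin (f - g) r = lin f r - lin g r :=
  (linHom r).map_sub f g

/-- The underlying left module of a left contramodule. -/
noncomputable instance (C : Contramodule R) : Module R C.carrier where
  smul a c := C.act (single a c)
  one_smul c := by
    change C.act (single 1 c) = c
    rw [single_one, act_point]
  mul_smul a b c := by
    change C.act (single (a * b) c) = C.act (single a (C.act (single b c)))
    rw [← map_single C.act, C.act_assoc, join_single_single]
  smul_zero a := by
    have h := (linHom (C := C) (single a ())).map_zero
    change C.act _ = _ at h
    rwa [map_single] at h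
  smul_add a c d := by
    have h := (linHom (C := C) (single a ())).map_add (fun _ => c) (fun _ => d)
    change C.act _ = C.act _ + C.act _ at h
    rwa [map_single, map_single, map_single] at h
  add_smul a b c := by
    change C.act (single (a + b) c) = _
    rw [single_add, act_add]
    rfl
  zero_smul c := by
    change C.act (single 0 c) = C.act 0
    rw [single_zero]

theorem act_single (a : R) (c : C.carrier) : C.act (single a c) = a • c :=
  rfl

theorem lin_single (f : X → C.carrier) (a : R) (x : X) : lin f (single a x) = a • f x := by
  rw [lin_apply, map_single, act_single]

theorem lin_ofFinsupp (f : X → C.carrier) (t : X →₀ R) :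
    lin f (ofFinsupp t) = Finsupp.linearCombination R f t := by
  suffices h : (lin f).comp ofFinsupp = (Finsupp.linearCombination R f).toAddMonoidHom from
    DFunLike.congr_fun h t
  refine Finsupp.addHom_ext fun x a => ?_
  exact (lin_single f a x).trans (Finsupp.linearCombination_single R a x).symm

theorem lin_mulRight (f : X → C.carrier) (a : X → R) (r : FormalSum R X) :
    lin f (mulRight a r) = lin (fun x => a x • f x) r := by
  rw [mulRight, lin_kleisli]
  simp only [lin_single]

theorem lin_const (c : C.carrier) (r : FormalSum R X) :
    lin (fun _ => c) r = (∑' x, r.1 x) • c := by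
  rw [lin_apply, FormalSum.map_const, act_single]

/-- The submodule `K C` of all infinite linear combinations of elements of a contramodule `C` with
coefficients in a left ideal `K`. -/
noncomputable def idealSpan (K : Ideal R) (C : Contramodule R) : Submodule R C.carrier where
  __ := (coeffIn K.toAddSubgroup C.carrier).map (lin id)
  smul_mem' := by
    rintro a _ ⟨r, hr, rfl⟩
    refine ⟨kleisli (fun _ => r) (single a ()), fun x => ?_, ?_⟩
    · rw [kleisli_single_apply]
      exact K.mul_mem_left a (hr x)
    · rw [lin_kleisli, lin_single]

theorem lin_mem_idealSpan {K : Ideal R} (hK : IsClosed (K : Set R)) (f : X → C.carrier)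
    {r : FormalSum R X} (hr : r ∈ coeffIn K.toAddSubgroup X) : lin f r ∈ idealSpan K C :=
  ⟨_, map_mem_coeffIn hK f hr, lin_id _⟩

theorem smul_mem_idealSpan {K : Ideal R} {a : R} (ha : a ∈ K) (c : C.carrier) :
    a • c ∈ idealSpan K C :=
  ⟨_, single_mem_coeffIn ha c, lin_id _⟩

end Contramodule

namespace Contramodule

variable {R : Type u} [Ring R] [UniformSpace R] [IsUniformAddGroup R] [IsTopologicalRing R]
  [CompleteSpace R] [T2Space R] [IsLinearTopology Rᵐᵒᵖ R] {C D : Contramodule R}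

open FormalSum

section Subcontramodule

/-- An additive subgroup of a contramodule is a subcontramodule if it is closed under infinite
linear combinations. -/
def IsSubcontramodule (B : AddSubgroup C.carrier) : Prop :=
  ∀ r : FormalSum R B, lin Subtype.val r ∈ B

variable {B : AddSubgroup C.carrier} (hB : IsSubcontramodule B) {X : Type*}

namespace IsSubcontramodule

include hB

theorem lin_mem {f : X → C.carrier} (hf : ∀ x, f x ∈ B) (r : FormalSum R X) : lin f r ∈ B := by
  have h := hB (FormalSum.map (fun x => ⟨f x, hf x⟩) r)
  rwa [lin_map] at h

theorem mk_lin_congr {f g : X → C.carrier}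
    (hfg : ∀ x, (f x : C.carrier ⧸ B) = (g x : C.carrier ⧸ B)) (r : FormalSum R X) :
    (lin f r : C.carrier ⧸ B) = (lin g r : C.carrier ⧸ B) := by
  rw [QuotientAddGroup.eq_iff_sub_mem, ← lin_sub_left]
  exact hB.lin_mem (fun x => QuotientAddGroup.eq_iff_sub_mem.1 (hfg x)) r

/-- The contramodule Nakayama lemma. -/
theorem eq_top_of_forall_exists_sub_mem {H : Ideal R} (hT : IsTopLeftTNilpotent H)
    (h : ∀ c, ∃ b ∈ B, c - b ∈ idealSpan H C) : B = ⊤ := by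
  choose b hbB s hs hsb using h
  refine (AddSubgroup.eq_top_iff' B).2 fun c => ?_
  obtain ⟨t, ht⟩ := hT.exists_eq_point_add_kleisli hs c
  have hlin : lin (id - b) t = lin id (kleisli s t) := by
    rw [lin_kleisli]
    congr 2
    exact (funext hsb).symm
  have hc : lin b t = c := by
    rw [← sub_sub_cancel (lin id t) (lin b t), ← lin_sub_left, hlin, ← map_sub,
      sub_eq_of_eq_add ht, lin_point, id]
  exact hc ▸ hB.lin_mem hbB t

/-- The quotient contramodule. -/
noncomputable def quotient : Contramodule R where
  carrier := C.carrier ⧸ B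
  act r := (lin Quotient.out r : C.carrier)
  act_point c := by
    rw [lin_point]
    exact Quotient.out_eq c
  act_assoc r := by
    rw [lin_map, join_eq_kleisli, lin_kleisli]
    exact hB.mk_lin_congr (fun s => Quotient.out_eq _) r

/-- The projection onto the quotient contramodule. -/
noncomputable def toQuotient : C ⟶ hB.quotient where
  toFun := QuotientAddGroup.mk
  map_act r := by
    rw [← lin_id]
    exact (hB.mk_lin_congr (fun c => (Quotient.out_eq _).symm) r).trans
      (congrArg _ (lin_map _ _ r).symm)

/-- The zero morphism to the quotient contramodule. -/
noncomputable def zeroToQuotient : C ⟶ hB.quotient where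
  toFun _ := (0 : C.carrier ⧸ B)
  map_act r := by
    refine Eq.trans ?_ (congrArg QuotientAddGroup.mk (lin_map _ _ r).symm)
    refine ((QuotientAddGroup.eq_zero_iff _).2 (hB.lin_mem (fun c => ?_) r)).symm
    exact (QuotientAddGroup.eq_zero_iff _).1 (Quotient.out_eq (0 : C.carrier ⧸ B))

end IsSubcontramodule

theorem isSubcontramodule_range_lin (f : X → C.carrier) : IsSubcontramodule (lin f).range :=
  fun r => by
    choose s hs using fun b : (lin f).range => b.2
    refine ⟨kleisli s r, ?_⟩
    rw [lin_kleisli]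
    exact congrArg (fun g => lin g r) (funext hs)

theorem surjective_of_epi (f : C ⟶ D) [Epi f] : Function.Surjective f.toFun := by
  have hB := isSubcontramodule_range_lin f.toFun
  have hcomp : f ≫ hB.toQuotient = f ≫ hB.zeroToQuotient :=
    Hom.ext <| funext fun c => (QuotientAddGroup.eq_zero_iff _).2 ⟨point c, lin_point _ c⟩
  intro d
  obtain ⟨r, hr⟩ := (QuotientAddGroup.eq_zero_iff _).1
    (congrFun (congrArg Hom.toFun ((cancel_epi f).1 hcomp)) d)
  exact ⟨C.act r, (f.map_act r).trans hr⟩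

end Subcontramodule

section Free

variable (R) in
/-- The free contramodule `R[[X]]` on a set `X`. -/
noncomputable def free (X : Type u) : Contramodule R where
  carrier := FormalSum R X
  act := join
  act_point := join_point
  act_assoc r := by
    rw [join_eq_kleisli (join r), join_eq_kleisli r, kleisli_kleisli]
    simp only [← join_eq_kleisli, id]
    rfl

variable {X : Type u}

/-- The morphism `R[[X]] ⟶ C` extending a map of sets `X → C`. -/
noncomputable def ofFree (f : X → C.carrier) : free R X ⟶ C where
  toFun := lin f
  map_act r := (congrArg (lin f) (join_eq_kleisli r)).trans (lin_kleisli f id r)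

theorem hom_free_apply (h : free R X ⟶ C) (r : FormalSum R X) :
    h.toFun r = lin (fun x => h.toFun (point x)) r := by
  refine Eq.trans ?_ (hom_lin h point r)
  exact congrArg h.toFun (kleisli_point_eq_self r).symm

instance projective_free : Projective (free R X) where
  factors h g _ := by
    choose a ha using fun x => surjective_of_epi g (h.toFun (point x))
    refine ⟨ofFree a, Hom.ext (funext fun r => ?_)⟩
    exact (hom_lin g a r).trans <|
      (congrArg (fun f => lin f r) (funext ha)).trans (hom_free_apply h r).symm

theorem projective_of_section (f : X → C.carrier) (ρ : C.carrier → FormalSum R X)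
    (hρ : ∀ c, lin f (ρ c) = c) (hact : ∀ r, ρ (C.act r) = kleisli ρ r) : Projective C :=
  Retract.projective (Y := free R X)
    { i := ⟨ρ, hact⟩, r := ofFree f, retract := Hom.ext (funext hρ) }

end Free

end Contramodule

section IdempotentLifting

theorem exists_seq_dvd_sq_sub_self_of_comm {A : Type*} [CommRing A] (a : A) :
    ∃ E : ℕ → A, E 0 = a ∧ (∀ n, (a ^ 2 - a) ^ (n + 1) ∣ E n ^ 2 - E n) ∧
      ∀ n, (a ^ 2 - a) ^ (n + 1) ∣ E (n + 1) - E n := by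
  -- Newton iteration for the equation `e ^ 2 = e`
  let E : ℕ → A := fun n => (fun p : A => 3 * p ^ 2 - 2 * p ^ 3)^[n] a
  have hE (n : ℕ) : E (n + 1) = 3 * E n ^ 2 - 2 * E n ^ 3 := Function.iterate_succ_apply' _ _ _
  have hdvd (n : ℕ) : (a ^ 2 - a) ^ (n + 1) ∣ E n ^ 2 - E n := by
    induction n with
    | zero => rw [zero_add, pow_one]; exact dvd_rfl
    | succ n ih =>
      have hsucc : E (n + 1) ^ 2 - E (n + 1) =
          (E n ^ 2 - E n) ^ 2 * (4 * E n ^ 2 - 4 * E n - 3) := by rw [hE]; ring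
      have hsq := pow_dvd_pow_of_dvd ih 2
      rw [← pow_mul] at hsq
      rw [hsucc]
      exact ((pow_dvd_pow _ (by lia)).trans hsq).mul_right _
  refine ⟨E, rfl, hdvd, fun n => ?_⟩
  have hdiff : E (n + 1) - E n = (E n ^ 2 - E n) * (1 - 2 * E n) := by rw [hE]; ring
  rw [hdiff]
  exact (hdvd n).mul_right _

theorem exists_seq_dvd_sq_sub_self {A : Type*} [Ring A] (a : A) :
    ∃ E : ℕ → A, E 0 = a ∧ (∀ n, (a ^ 2 - a) ^ (n + 1) ∣ E n ^ 2 - E n) ∧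
      ∀ n, (a ^ 2 - a) ^ (n + 1) ∣ E (n + 1) - E n := by
  obtain ⟨E, h0, hE, hE'⟩ := exists_seq_dvd_sq_sub_self_of_comm (Polynomial.X : Polynomial ℤ)
  refine ⟨fun n => Polynomial.aeval a (E n),
    (congrArg (Polynomial.aeval a) h0).trans (Polynomial.aeval_X a),
    fun n => ?_, fun n => ?_⟩
  · simpa using map_dvd (Polynomial.aeval a) (hE n)
  · simpa using map_dvd (Polynomial.aeval a) (hE' n)

variable {R : Type u} [Ring R] [UniformSpace R] [IsUniformAddGroup R] [IsTopologicalRing R]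
  [CompleteSpace R] [T2Space R] [IsLinearTopology Rᵐᵒᵖ R]

theorem IsTopLeftTNilpotent.exists_isIdempotentElem_mk_eq {H : Ideal R} [H.IsTwoSided]
    (hT : IsTopLeftTNilpotent H) (hc : IsClosed (H : Set R)) {x : R ⧸ H}
    (hx : IsIdempotentElem x) : ∃ e : R, IsIdempotentElem e ∧ Ideal.Quotient.mk H e = x := by
  obtain ⟨a, rfl⟩ := Ideal.Quotient.mk_surjective x
  obtain ⟨E, h0, hE, hE'⟩ := exists_seq_dvd_sq_sub_self a
  set z := a ^ 2 - a
  have hzH : z ∈ H := by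
    rw [← Ideal.Quotient.mk_eq_mk_iff_sub_mem, sq, map_mul, hx.eq]
  have hpow : Tendsto (fun n => z ^ (n + 1)) cofinite (𝓝 0) := by
    simpa only [List.map_const', List.prod_replicate, List.length_range, Nat.cofinite_eq_atTop]
      using hT (fun _ => z) fun _ => hzH
  have htend {b : ℕ → R} (hb : ∀ n, z ^ (n + 1) ∣ b n) : Tendsto b cofinite (𝓝 0) := by
    choose q hq using hb
    rw [funext hq]
    exact IsLinearTopology.tendsto_mul_zero_of_left _ q hpow
  have hlim : Tendsto E atTop (𝓝 (∑' n, (E (n + 1) - E n) + a)) := by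
    refine ((FormalSum.summable_of_tendsto (htend hE')).hasSum.tendsto_sum_nat.add_const a).congr
      fun n => ?_
    rw [Finset.sum_range_sub E, h0, sub_add_cancel]
  refine ⟨_, sub_eq_zero.1 (tendsto_nhds_unique ((hlim.mul hlim).sub hlim) ?_), ?_⟩
  · simpa only [sq, Nat.cofinite_eq_atTop] using htend hE
  · rw [Ideal.Quotient.mk_eq_mk_iff_sub_mem, add_sub_cancel_right]
    refine tsum_mem (s := H.toAddSubgroup) hc fun n => ?_
    obtain ⟨q, hq⟩ := hE' n
    rw [hq, pow_succ]
    exact H.mul_mem_right q (H.mul_mem_left _ hzH)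

end IdempotentLifting

section IdempotentCoordinates

variable {R : Type*} [Ring R] (K : Ideal R) [K.IsTwoSided]

/-- Coordinates on an `R`-module `G` exhibiting it as the direct sum of the left ideals of `R ⧸ K`
generated by the idempotents `e y`, the generator of the `y`-th summand being `v y`. -/
structure IdempotentCoordinates (G : Type*) [AddCommGroup G] [Module R G] (Y : Type*) where
  /-- the generators -/
  v : Y → G
  /-- the idempotents -/
  e : Y → R ⧸ K
  /-- the coordinate functions -/
  φ : Y → G →ₗ[R] R ⧸ K
  isIdempotentElem (y : Y) : IsIdempotentElem (e y)
  smul_v {y : Y} {a : R} (ha : Ideal.Quotient.mk K a = e y) : a • v y = v y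
  φ_self (y : Y) : φ y (v y) = e y
  φ_of_ne {y y' : Y} (h : y ≠ y') : φ y (v y') = 0
  span_range_v : Submodule.span R (Set.range v) = ⊤

variable {K} [IsSemisimpleRing (R ⧸ K)]

theorem isSemisimpleModule_of_isTorsionBySet {G : Type*} [AddCommGroup G] [Module R G]
    (hG : Module.IsTorsionBySet R G K) : IsSemisimpleModule R G :=
  letI := hG.module
  hG.isSemisimpleModule_iff.1 inferInstance

omit [IsSemisimpleRing (R ⧸ K)] in
theorem isTorsionBySet_quotient : Module.IsTorsionBySet R (R ⧸ K) K := by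
  rintro x ⟨k, hk⟩
  obtain ⟨a, rfl⟩ := Ideal.Quotient.mk_surjective x
  exact Ideal.Quotient.eq_zero_iff_mem.2 (K.mul_mem_right a hk)

theorem exists_idempotent_section_of_isSimpleModule {L : Type*} [AddCommGroup L] [Module R L]
    [IsSimpleModule R L] (hL : Module.IsTorsionBySet R L K) :
    ∃ (v : L) (ψ : L →ₗ[R] R ⧸ K), IsIdempotentElem (ψ v) ∧ v ≠ 0 ∧
      ∀ a, Ideal.Quotient.mk K a = ψ v → a • v = v := by
  have := IsSimpleModule.nontrivial R L
  obtain ⟨v, hv⟩ := exists_ne (0 : L)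
  let q : R ⧸ K →ₗ[R] L := K.liftQ (LinearMap.toSpanSingleton R L v) fun k hk => @hL v ⟨k, hk⟩
  have hq : Function.Surjective q := fun l => by
    obtain ⟨a, rfl⟩ := IsSimpleModule.toSpanSingleton_surjective R hv l
    exact ⟨Ideal.Quotient.mk K a, rfl⟩
  have := isSemisimpleModule_of_isTorsionBySet (isTorsionBySet_quotient (K := K))
  obtain ⟨ψ, hψ⟩ := IsSemisimpleModule.lifting_property q hq LinearMap.id
  have hfix (a : R) (ha : Ideal.Quotient.mk K a = ψ v) : a • v = v :=
    (congrArg q ha).trans (LinearMap.congr_fun hψ v)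
  refine ⟨v, ψ, ?_, hv, hfix⟩
  obtain ⟨a, ha⟩ := Ideal.Quotient.mk_surjective (ψ v)
  calc ψ v * ψ v = Ideal.Quotient.mk K a * ψ v := by rw [ha]
    _ = ψ (a • v) := (ψ.map_smul a v).symm
    _ = ψ v := by rw [hfix a ha]

theorem exists_idempotentCoordinates {G : Type u} [AddCommGroup G] [Module R G]
    (hG : Module.IsTorsionBySet R G K) : ∃ Y : Type u, Nonempty (IdempotentCoordinates K G Y) := by
  classical
  have := isSemisimpleModule_of_isTorsionBySet hG
  obtain ⟨s, f, -, hs⟩ := IsSemisimpleModule.exists_linearEquiv_dfinsupp R G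
  choose v ψ hidem hv hfix using fun y : s =>
    exists_idempotent_section_of_isSimpleModule (K := K) (L := y.1)
      fun {l k} => Subtype.ext (@hG l k)
  have hfv (y : s) : f (f.symm (DFinsupp.single y (v y))) = DFinsupp.single y (v y) :=
    f.apply_symm_apply _
  refine ⟨s, ⟨fun y => f.symm (DFinsupp.single y (v y)), fun y => ψ y (v y),
    fun y => ψ y ∘ₗ DFinsupp.lapply y ∘ₗ f.toLinearMap, hidem, ?_, ?_, ?_, ?_⟩⟩
  · intro y a ha
    rw [← map_smul, ← DFinsupp.single_smul, hfix y a ha]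
  · intro y
    change ψ y (f (f.symm _) y) = _
    rw [hfv, DFinsupp.single_eq_same]
  · intro y y' h
    change ψ y (f (f.symm _) y) = _
    rw [hfv, DFinsupp.single_eq_of_ne h, map_zero]
  · refine eq_top_iff.2 fun g _ => ?_
    rw [← f.symm_apply_apply g]
    induction f g using DFinsupp.induction with
    | h0 => exact f.symm.map_zero ▸ Submodule.zero_mem _
    | ha y l d _ _ hd =>
      obtain ⟨a, rfl⟩ := IsSimpleModule.toSpanSingleton_surjective R (hv y) l
      rw [map_add, LinearMap.toSpanSingleton_apply, DFinsupp.single_smul, map_smul]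
      exact Submodule.add_mem _ (Submodule.smul_mem _ a (Submodule.subset_span ⟨y, rfl⟩)) hd

end IdempotentCoordinates

section SemisimpleDecomposition

variable {R : Type u} [Ring R] [TopologicalSpace R] [IsTopologicalRing R]

/-- A decomposition of the topological ring `R ⧸ H` into a product of discrete semisimple rings
`R ⧸ K γ`, expressed inside `R`: the elements `ε γ` lift the central idempotents of the factors,
and zero-convergent families of elements of `R ⧸ H` lift to zero-convergent families in `R`. -/
structure SemisimpleDecomposition (H : Ideal R) (Γ : Type u) where
  /-- the kernels of the projections to the factors -/
  K : Γ → Ideal R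
  isTwoSided (γ : Γ) : (K γ).IsTwoSided
  isOpen (γ : Γ) : IsOpen (K γ : Set R)
  isSemisimpleRing (γ : Γ) : IsSemisimpleRing (R ⧸ K γ)
  /-- the lifts of the central idempotents -/
  ε : FormalSum R Γ
  ε_mem {γ γ' : Γ} (h : γ' ≠ γ) : ε.1 γ ∈ K γ'
  ε_sub_one_mem (γ : Γ) : ε.1 γ - 1 ∈ K γ
  mem_iff {a : R} : a ∈ H ↔ ∀ γ, a ∈ K γ
  exists_lift {X : Type u} {s : X → R} (hs : ∀ γ, {x | s x ∉ K γ}.Finite) :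
    ∃ r : FormalSum R X, ∀ x, r.1 x - s x ∈ H

namespace SemisimpleDecomposition

open FormalSum Contramodule

variable {H : Ideal R} {Γ : Type u} (D : SemisimpleDecomposition H Γ)

attribute [instance] isTwoSided isSemisimpleRing

theorem isClosed_K (γ : Γ) : IsClosed (D.K γ : Set R) :=
  (D.K γ).toAddSubgroup.isClosed_of_isOpen (D.isOpen γ)

include D in
theorem isClosed : IsClosed (H : Set R) := by
  have h : (H : Set R) = ⋂ γ, (D.K γ : Set R) := Set.ext fun a => by
    rw [Set.mem_iInter]
    exact D.mem_iff
  rw [h]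
  exact isClosed_iInter D.isClosed_K

theorem mem_of_mem_of_forall_ne {γ : Γ} {a : R} (h : a ∈ D.K γ) (h' : ∀ γ', γ' ≠ γ → a ∈ D.K γ') :
    a ∈ H :=
  D.mem_iff.2 fun γ' => (eq_or_ne γ' γ).elim (fun e => e ▸ h) (h' γ')

theorem mul_ε_mem {γ : Γ} {a : R} (ha : a ∈ D.K γ) : a * D.ε.1 γ ∈ H :=
  D.mem_of_mem_of_forall_ne ((D.K γ).mul_mem_right _ ha)
    fun γ' h => (D.K γ').mul_mem_left a (D.ε_mem h)

theorem mul_ε_sub_mem (γ : Γ) (a : R) : a * D.ε.1 γ - a ∈ D.K γ := by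
  rw [← mul_sub_one]
  exact (D.K γ).mul_mem_left a (D.ε_sub_one_mem γ)

/-- The inclusion of a factor into the product ring `R ⧸ H`. -/
noncomputable def incl (γ : Γ) : R ⧸ D.K γ →ₗ[R] R ⧸ H :=
  (D.K γ).liftQ (H.mkQ ∘ₗ LinearMap.toSpanSingleton R R (D.ε.1 γ)) fun _ ha =>
    (Submodule.Quotient.mk_eq_zero H).2 (D.mul_ε_mem ha)

variable [H.IsTwoSided]

theorem incl_mk (γ : Γ) (a : R) :
    D.incl γ (Ideal.Quotient.mk (D.K γ) a) = Ideal.Quotient.mk H (a * D.ε.1 γ) :=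
  rfl

theorem mk_eq_of_mk_eq_incl {γ : Γ} {a : R} {z : R ⧸ D.K γ}
    (h : Ideal.Quotient.mk H a = D.incl γ z) : Ideal.Quotient.mk (D.K γ) a = z := by
  obtain ⟨b, rfl⟩ := Ideal.Quotient.mk_surjective z
  rw [incl_mk, Ideal.Quotient.mk_eq_mk_iff_sub_mem] at h
  rw [Ideal.Quotient.mk_eq_mk_iff_sub_mem, ← sub_add_sub_cancel a (b * D.ε.1 γ)]
  exact (D.K γ).add_mem (D.mem_iff.1 h γ) (D.mul_ε_sub_mem γ b)

theorem mem_of_mk_eq_incl {γ γ' : Γ} (hne : γ' ≠ γ) {a : R} {z : R ⧸ D.K γ}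
    (h : Ideal.Quotient.mk H a = D.incl γ z) : a ∈ D.K γ' := by
  obtain ⟨b, rfl⟩ := Ideal.Quotient.mk_surjective z
  rw [incl_mk, Ideal.Quotient.mk_eq_mk_iff_sub_mem] at h
  rw [← sub_add_cancel a (b * D.ε.1 γ)]
  exact (D.K γ').add_mem (D.mem_iff.1 h γ') ((D.K γ').mul_mem_left b (D.ε_mem hne))

theorem incl_mul_incl (γ : Γ) (z z' : R ⧸ D.K γ) :
    D.incl γ z * D.incl γ z' = D.incl γ (z * z') := by
  obtain ⟨a, rfl⟩ := Ideal.Quotient.mk_surjective z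
  obtain ⟨b, rfl⟩ := Ideal.Quotient.mk_surjective z'
  have h : a * D.ε.1 γ * (b * D.ε.1 γ) - a * b * D.ε.1 γ =
      a * (D.ε.1 γ - 1) * b * D.ε.1 γ := by noncomm_ring
  rw [← map_mul (Ideal.Quotient.mk (D.K γ)), incl_mk, incl_mk, incl_mk, ← map_mul,
    Ideal.Quotient.mk_eq_mk_iff_sub_mem, h]
  exact D.mul_ε_mem ((D.K γ).mul_mem_right b ((D.K γ).mul_mem_left a (D.ε_sub_one_mem γ)))

end SemisimpleDecomposition

end SemisimpleDecomposition

section CoordinateSystem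

variable {R : Type u} [Ring R] [UniformSpace R] [IsUniformAddGroup R] [IsTopologicalRing R]
  [CompleteSpace R] [T2Space R] [IsLinearTopology Rᵐᵒᵖ R]

open FormalSum Contramodule

namespace SemisimpleDecomposition

variable {H : Ideal R} {Γ : Type u} (D : SemisimpleDecomposition H Γ) {F : Contramodule R}
include D

theorem tsum_ε_sub_one_mem : ∑' γ, D.ε.1 γ - 1 ∈ H := by
  classical
  refine D.mem_iff.2 fun γ => ?_
  rw [(summable_of_tendsto D.ε.2).tsum_eq_add_tsum_ite γ, add_sub_right_comm]
  refine (D.K γ).add_mem (D.ε_sub_one_mem γ)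
    (tsum_mem (s := (D.K γ).toAddSubgroup) (D.isClosed_K γ) fun γ' => ?_)
  split_ifs with h
  · exact (D.K γ).zero_mem
  · exact D.ε_mem (Ne.symm h)

theorem mem_idealSpan_of_forall {c : F.carrier} (h : ∀ γ, c ∈ idealSpan (D.K γ) F) :
    c ∈ idealSpan H F := by
  choose t ht htc using h
  have hε : lin (fun _ => c) D.ε ∈ idealSpan H F := by
    rw [← funext htc, ← lin_kleisli]
    refine lin_mem_idealSpan D.isClosed id fun c' => ?_
    rw [kleisli_apply]
    refine tsum_mem (s := H.toAddSubgroup) D.isClosed fun γ => ?_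
    refine D.mem_of_mem_of_forall_ne (γ := γ) ((D.K γ).mul_mem_left _ (ht γ c')) fun γ' h => ?_
    exact (D.K γ').mul_mem_right _ (D.ε_mem h)
  rw [lin_const] at hε
  have hc := (idealSpan H F).sub_mem hε (smul_mem_idealSpan D.tsum_ε_sub_one_mem c)
  rwa [← sub_smul, sub_sub_cancel, one_smul] at hc

theorem exists_sub_lin_mem_idealSpan {Y : Γ → Type u} (f : (Σ γ, Y γ) → F.carrier)
    (hf : ∀ γ c, ∃ t : Y γ →₀ R,
      c - Finsupp.linearCombination R (f ∘ Sigma.mk γ) t ∈ idealSpan (D.K γ) F)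
    (c : F.carrier) : ∃ r : FormalSum R (Σ γ, Y γ), c - lin f r ∈ idealSpan H F := by
  choose t ht using fun γ => hf γ c
  have hfin (γ : Γ) : {x : Σ γ, Y γ | t x.1 x.2 * D.ε.1 x.1 ∉ D.K γ}.Finite := by
    refine ((t γ).support.finite_toSet.image (Sigma.mk γ)).subset fun ⟨γ', y⟩ hx => ?_
    obtain rfl : γ' = γ := by
      by_contra hne
      exact hx ((D.K γ).mul_mem_left _ (D.ε_mem (Ne.symm hne)))
    exact ⟨y, Finsupp.mem_support_iff.2 fun h0 => hx (by simp [h0]), rfl⟩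
  obtain ⟨r, hr⟩ := D.exists_lift hfin
  refine ⟨r, D.mem_idealSpan_of_forall fun γ => ?_⟩
  let tγ : (Σ γ, Y γ) →₀ R := (t γ).embDomain (Function.Embedding.sigmaMk γ)
  have hrt : r - ofFinsupp tγ ∈ coeffIn (D.K γ).toAddSubgroup _ := fun ⟨γ', y⟩ => by
    change r.1 _ - tγ ⟨γ', y⟩ ∈ D.K γ
    have hrK := D.mem_iff.1 (hr ⟨γ', y⟩) γ
    by_cases hne : γ' = γ
    · subst hne
      have h := (D.K γ').add_mem hrK (D.mul_ε_sub_mem γ' (t γ' y))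
      rw [sub_add_sub_cancel] at h
      rwa [← Function.Embedding.sigmaMk_apply, Finsupp.embDomain_apply_self]
    · rw [Finsupp.embDomain_of_notMem_range, sub_zero]
      · have h := (D.K γ).add_mem hrK ((D.K γ).mul_mem_left (t γ' y) (D.ε_mem (Ne.symm hne)))
        rwa [sub_add_cancel] at h
      · rintro ⟨y', hy'⟩
        exact hne (congrArg Sigma.fst hy').symm
  have hlin := lin_mem_idealSpan (D.isClosed_K γ) f hrt
  rw [map_sub, lin_ofFinsupp, Finsupp.linearCombination_embDomain] at hlin
  rw [← sub_sub_sub_cancel_right c _ (Finsupp.linearCombination R (f ∘ Sigma.mk γ) (t γ))]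
  exact (idealSpan (D.K γ) F).sub_mem (ht γ) hlin

end SemisimpleDecomposition

/-- Generators of a contramodule `F` modulo `H F`, together with continuous coordinates on `F` with
values in `R ⧸ H`; on the generators the coordinates are given by idempotents of `R`. -/
structure CoordinateSystem (H : Ideal R) [H.IsTwoSided] (F : Contramodule R) (X : Type u) where
  /-- the generators -/
  f : X → F.carrier
  /-- the idempotents -/
  e : X → R
  /-- the coordinates -/
  φ : X → F.carrier →ₗ[R] R ⧸ H
  isIdempotentElem (x : X) : IsIdempotentElem (e x)
  e_smul_f (x : X) : e x • f x = f x
  φ_self (x : X) : φ x (f x) = Ideal.Quotient.mk H (e x)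
  φ_of_ne {x x' : X} (h : x ≠ x') : φ x (f x') = 0
  exists_isOpen (x : X) : ∃ V : AddSubgroup R, IsOpen (V : Set R) ∧
    ∀ r ∈ coeffIn V F.carrier, φ x (F.act r) = 0
  exists_sub_lin_mem_idealSpan (c : F.carrier) :
    ∃ r : FormalSum R X, c - lin f r ∈ idealSpan H F

theorem Contramodule.isTorsionBySet_quotient_idealSpan (K : Ideal R) (F : Contramodule R) :
    Module.IsTorsionBySet R (F.carrier ⧸ idealSpan K F) K := by
  rintro x ⟨k, hk⟩
  obtain ⟨c, rfl⟩ := Submodule.mkQ_surjective _ x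
  exact (Submodule.Quotient.mk_eq_zero _).2 (smul_mem_idealSpan hk c)

theorem exists_sub_linearCombination_mem {R M Y : Type*} [Ring R] [AddCommGroup M] [Module R M]
    {B : Submodule R M} {f : Y → M} (hf : Submodule.span R (Set.range (B.mkQ ∘ f)) = ⊤) (c : M) :
    ∃ t : Y →₀ R, c - Finsupp.linearCombination R f t ∈ B := by
  obtain ⟨t, ht⟩ := Finsupp.mem_span_range_iff_exists_finsupp.1
    (hf ▸ Submodule.mem_top : B.mkQ c ∈ Submodule.span R (Set.range (B.mkQ ∘ f)))
  refine ⟨t, (Submodule.Quotient.mk_eq_zero B).1 ?_⟩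
  rw [← B.mkQ_apply, map_sub, B.mkQ.map_finsupp_linearCombination, sub_eq_zero]
  exact ht.symm

theorem SemisimpleDecomposition.exists_isIdempotentElem_smul_eq {H : Ideal R} [H.IsTwoSided]
    (hT : IsTopLeftTNilpotent H) {Γ : Type u} (D : SemisimpleDecomposition H Γ)
    {F : Contramodule R} {γ : Γ} {Y : Type u}
    (C : IdempotentCoordinates (D.K γ) (F.carrier ⧸ idealSpan (D.K γ) F) Y) (y : Y) :
    ∃ (e : R) (f : F.carrier), IsIdempotentElem e ∧ e • f = f ∧
      Ideal.Quotient.mk H e = D.incl γ (C.e y) ∧ (idealSpan (D.K γ) F).mkQ f = C.v y ∧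
      ∀ γ' ≠ γ, (idealSpan (D.K γ') F).mkQ f = 0 := by
  obtain ⟨e, he, hee⟩ := hT.exists_isIdempotentElem_mk_eq D.isClosed (x := D.incl γ (C.e y)) (by
    rw [IsIdempotentElem, incl_mul_incl, C.isIdempotentElem])
  obtain ⟨w, hw⟩ := Submodule.mkQ_surjective _ (C.v y)
  refine ⟨e, e • w, he, by rw [← mul_smul, he], hee, ?_, fun γ' hγ => ?_⟩
  · rw [map_smul, hw, C.smul_v (D.mk_eq_of_mk_eq_incl hee)]
  · exact (Submodule.Quotient.mk_eq_zero _).2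
      (smul_mem_idealSpan (D.mem_of_mk_eq_incl hγ hee) w)

theorem SemisimpleDecomposition.exists_coordinateSystem {H : Ideal R} [H.IsTwoSided]
    (hT : IsTopLeftTNilpotent H) {Γ : Type u} (D : SemisimpleDecomposition H Γ)
    (F : Contramodule R) : ∃ X : Type u, Nonempty (CoordinateSystem H F X) := by
  choose Y hY using fun γ =>
    exists_idempotentCoordinates (isTorsionBySet_quotient_idealSpan (D.K γ) F)
  let C (γ : Γ) := (hY γ).some
  choose e f he hef hee hfv hf0 using fun x : Σ γ, Y γ =>
    D.exists_isIdempotentElem_smul_eq hT (C x.1) x.2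
  have hne {x x' : Σ γ, Y γ} (h : x ≠ x') :
      (C x.1).φ x.2 ((idealSpan (D.K x.1) F).mkQ (f x')) = 0 := by
    obtain ⟨γ, y⟩ := x
    obtain ⟨γ', y'⟩ := x'
    by_cases hγ : γ = γ'
    · subst hγ
      rw [hfv ⟨γ, y'⟩, (C γ).φ_of_ne fun hy => h (congrArg (Sigma.mk γ) hy)]
    · rw [hf0 ⟨γ', y'⟩ γ hγ, map_zero]
  have hact (x : Σ γ, Y γ) {r : FormalSum R F.carrier}
      (hr : r ∈ coeffIn (D.K x.1).toAddSubgroup F.carrier) :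
      (idealSpan (D.K x.1) F).mkQ (F.act r) = 0 :=
    (Submodule.Quotient.mk_eq_zero _).2 ⟨r, hr, lin_id r⟩
  have hspan (γ : Γ) : Submodule.span R
      (Set.range ((idealSpan (D.K γ) F).mkQ ∘ f ∘ Sigma.mk γ)) = ⊤ := by
    rw [← (C γ).span_range_v]
    exact congrArg (fun v => Submodule.span R (Set.range v)) (funext fun y => hfv ⟨γ, y⟩)
  exact ⟨Σ γ, Y γ, ⟨{
    f := f
    e := e
    φ := fun x => D.incl x.1 ∘ₗ (C x.1).φ x.2 ∘ₗ (idealSpan (D.K x.1) F).mkQ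
    isIdempotentElem := he
    e_smul_f := hef
    φ_self := fun x => by
      rw [LinearMap.comp_apply, LinearMap.comp_apply, hfv, (C x.1).φ_self, hee]
    φ_of_ne := fun h => by
      rw [LinearMap.comp_apply, LinearMap.comp_apply, hne h, map_zero]
    exists_isOpen := fun x => ⟨(D.K x.1).toAddSubgroup, D.isOpen x.1, fun r hr => by
      rw [LinearMap.comp_apply, LinearMap.comp_apply, hact x hr, map_zero, map_zero]⟩
    exists_sub_lin_mem_idealSpan := D.exists_sub_lin_mem_idealSpan _ fun γ =>
      exists_sub_linearCombination_mem (hspan γ) }⟩⟩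

end CoordinateSystem

namespace IsDiscreteRightModule

variable {R : Type*} [Ring R] {N N' : Type*} [AddCommGroup N] [Module Rᵐᵒᵖ N] [AddCommGroup N']
  [Module Rᵐᵒᵖ N']

variable (R N) in
/-- The action of `R` on a right `R`-module, as a biadditive map. -/
def smulHom : R →+ N →+ N :=
  (smulAddHom Rᵐᵒᵖ N).comp (MulOpposite.opAddEquiv : R ≃+ Rᵐᵒᵖ).toAddMonoidHom

variable (R) in
/-- The annihilator in `R` of an element of a right `R`-module. -/
def annihilator (b : N) : AddSubgroup R :=
  ((smulHom R N).flip b).ker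

variable [TopologicalSpace R] (g : N →ₗ[Rᵐᵒᵖ] N')

theorem of_injective [IsDiscreteRightModule R N'] (hg : Function.Injective g) :
    IsDiscreteRightModule R N where
  isOpen_annihilator b := by
    convert isOpen_annihilator (R := R) (g b) using 3
    rw [← map_smul, map_eq_zero_iff g hg]

instance [IsDiscreteRightModule R N] (M : Submodule Rᵐᵒᵖ N) : IsDiscreteRightModule R M :=
  of_injective M.subtype M.injective_subtype

variable [IsTopologicalRing R]

theorem of_surjective [IsDiscreteRightModule R N] (hg : Function.Surjective g) :
    IsDiscreteRightModule R N' where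
  isOpen_annihilator b' := by
    obtain ⟨b, rfl⟩ := hg b'
    have hle : annihilator R b ≤ annihilator R (g b) := fun r (hr : MulOpposite.op r • b = 0) =>
      show MulOpposite.op r • g b = 0 by rw [← map_smul, hr, map_zero]
    exact AddSubgroup.isOpen_mono hle (isOpen_annihilator b)

instance [IsDiscreteRightModule R N] (M : Submodule Rᵐᵒᵖ N) : IsDiscreteRightModule R (N ⧸ M) :=
  of_surjective M.mkQ M.mkQ_surjective

theorem quotient {I : Submodule Rᵐᵒᵖ R} (hI : IsOpen (I : Set R)) :
    IsDiscreteRightModule R (R ⧸ I) where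
  isOpen_annihilator b := by
    obtain ⟨a, rfl⟩ := I.mkQ_surjective b
    have h : {r : R | MulOpposite.op r • I.mkQ a = 0} = (fun r => a * r) ⁻¹' I :=
      Set.ext fun r => Submodule.Quotient.mk_eq_zero I
    rw [h]
    exact hI.preimage (continuous_const_mul a)

end IsDiscreteRightModule

namespace FormalSum

open IsDiscreteRightModule

variable {R : Type u} [Ring R] [UniformSpace R] [IsTopologicalRing R] {N : Type*}
  [AddCommGroup N] [Module Rᵐᵒᵖ N] [IsDiscreteRightModule R N] {X : Type*} (b : N)

theorem smulLeft_apply (r : FormalSum R X) (x : X) :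
    smulLeft b r x = MulOpposite.op (r.1 x) • b :=
  rfl

/-- The map `r ↦ b r` from `R[[X]]` to `N[X]`, as a homomorphism. -/
noncomputable def smulLeftHom : FormalSum R X →+ X →₀ N :=
  AddMonoidHom.mk' (smulLeft b) fun r s => Finsupp.ext fun x =>
    add_smul (MulOpposite.op (r.1 x)) (MulOpposite.op (s.1 x)) b

theorem smulLeft_single (a : R) (x : X) :
    smulLeft b (single a x) = Finsupp.single x (MulOpposite.op a • b) := by
  ext y
  rcases eq_or_ne y x with rfl | h
  · rw [smulLeft_apply, single_self, Finsupp.single_eq_same]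
  · rw [smulLeft_apply, single_of_ne a h, Finsupp.single_eq_of_ne h, MulOpposite.op_zero, zero_smul]

theorem smulLeft_eq_zero {r : FormalSum R X} (hr : r ∈ coeffIn (annihilator R b) X) :
    smulLeft b r = 0 :=
  Finsupp.ext hr

/-- Both sides are additive in `r`, so it suffices to compare them on `a x` and on the
combinations with sufficiently small coefficients. -/
theorem hom_apply_eq_sum_smulLeft {A : Type*} [AddCommGroup A] (g : FormalSum R X →+ A)
    (β : X → N →+ A) {V : AddSubgroup R} (hV : IsOpen (V : Set R))
    (hg : ∀ r ∈ coeffIn V X, g r = 0) (h : ∀ a x, g (single a x) = β x (MulOpposite.op a • b))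
    (r : FormalSum R X) : g r = (smulLeft b r).sum fun x n => β x n := by
  have hVb : IsOpen ((V ⊓ annihilator R b : AddSubgroup R) : Set R) :=
    hV.inter (isOpen_annihilator b)
  refine DFunLike.congr_fun (g := (Finsupp.liftAddHom β).comp (smulLeftHom b))
    (hom_ext_of_isOpen hVb (fun s hs => ?_) fun a x => ?_) r
  · have hs0 : smulLeftHom b s = 0 := smulLeft_eq_zero b fun x => (hs x).2
    rw [hg s fun x => (hs x).1, AddMonoidHom.comp_apply, hs0, map_zero]
  · have hsingle : smulLeftHom b (single a x) = _ := smulLeft_single b a x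
    rw [h, AddMonoidHom.comp_apply, hsingle, Finsupp.liftAddHom_apply_single]

end FormalSum

namespace Contratensor

open FormalSum Contramodule IsDiscreteRightModule

variable {R : Type u} [Ring R] [UniformSpace R] [IsUniformAddGroup R] [IsTopologicalRing R]
  [CompleteSpace R] [T2Space R] [IsLinearTopology Rᵐᵒᵖ R]
  {N : Type*} [AddCommGroup N] [Module Rᵐᵒᵖ N] [IsDiscreteRightModule R N] {F : Contramodule R}

variable (N F) in
/-- The class of a pure tensor in the contratensor product, as a biadditive map. -/
noncomputable def tmul : N →+ F.carrier →+ Contratensor N F :=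
  AddMonoidHom.mk' (fun b => (QuotientAddGroup.mk' (relations N F)).comp
    (TensorProduct.mk ℤ N F.carrier b).toAddMonoidHom) fun b b' => by
      ext c
      exact congrArg _ (TensorProduct.add_tmul b b' c)

theorem tmul_act (b : N) (r : FormalSum R F.carrier) :
    tmul N F b (F.act r) = (smulLeft b r).sum fun c n => tmul N F n c := by
  have h := (QuotientAddGroup.eq_iff_sub_mem (N := relations N F)).2
    (AddSubgroup.subset_closure ⟨(b, r), rfl⟩)
  exact h.trans (map_finsuppSum (QuotientAddGroup.mk' (relations N F)) _ _)

theorem tmul_smul (b : N) (a : R) (c : F.carrier) :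
    tmul N F b (a • c) = tmul N F (MulOpposite.op a • b) c := by
  rw [← act_single, tmul_act, smulLeft_single, Finsupp.sum_single_index]
  rw [map_zero, AddMonoidHom.zero_apply]

theorem tmul_lin {X : Type*} (b : N) (f : X → F.carrier) (r : FormalSum R X) :
    tmul N F b (lin f r) = (smulLeft b r).sum fun x n => tmul N F n (f x) := by
  have hV : IsOpen (annihilator R b : Set R) := isOpen_annihilator b
  refine hom_apply_eq_sum_smulLeft b ((tmul N F b).comp (lin f)) (fun x => (tmul N F).flip (f x))
    hV (fun r hr => ?_) (fun a x => ?_) r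
  · have h : smulLeft b (FormalSum.map f r) = 0 := smulLeft_eq_zero b
      (map_mem_coeffIn (AddSubgroup.isClosed_of_isOpen _ hV) f hr)
    rw [AddMonoidHom.comp_apply, lin_apply, tmul_act, h, Finsupp.sum_zero_index]
  · rw [AddMonoidHom.comp_apply, lin_single, tmul_smul, AddMonoidHom.flip_apply]

theorem exists_hom_tmul {A : Type*} [AddCommGroup A] (β : N →+ F.carrier →+ A)
    (hact : ∀ b, ∃ V : AddSubgroup R, IsOpen (V : Set R) ∧
      ∀ r ∈ coeffIn V F.carrier, β b (F.act r) = 0)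
    (hsmul : ∀ b (a : R) c, β b (a • c) = β (MulOpposite.op a • b) c) :
    ∃ ψ : Contratensor N F →+ A, ∀ b c, ψ (tmul N F b c) = β b c := by
  let ψ : N ⊗[ℤ] F.carrier →+ A := TensorProduct.liftAddHom β fun k b c => by
    rw [map_zsmul, map_zsmul, AddMonoidHom.zsmul_apply]
  have hψ (b : N) (c : F.carrier) : ψ (b ⊗ₜ[ℤ] c) = β b c := TensorProduct.liftAddHom_tmul _ _ _ _
  refine ⟨QuotientAddGroup.lift (relations N F) ψ ?_, hψ⟩
  rw [relations, AddSubgroup.closure_le]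
  rintro _ ⟨⟨b, r⟩, rfl⟩
  obtain ⟨V, hV, hVβ⟩ := hact b
  have h : β b (F.act r) = (smulLeft b r).sum fun c n => β n c := by
    rw [← lin_id]
    refine hom_apply_eq_sum_smulLeft b ((β b).comp (lin id)) (fun c => β.flip c) hV
      (fun r hr => ?_) (fun a c => ?_) r
    · rw [AddMonoidHom.comp_apply, lin_id, hVβ r hr]
    · rw [AddMonoidHom.comp_apply, lin_single, id, hsmul, AddMonoidHom.flip_apply]
  rw [SetLike.mem_coe, AddMonoidHom.mem_ker, map_sub, hψ, h, map_finsuppSum, sub_eq_zero]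
  exact Finsupp.sum_congr fun c _ => (hψ _ c).symm

end Contratensor

theorem exists_isSimpleModule_map_mkQ {A P : Type*} [Ring A] [AddCommGroup P] [Module A P]
    {S : Submodule A P} (hS : S.FG) (hS0 : S ≠ ⊥) :
    ∃ L : Submodule A P, IsSimpleModule A (S.map L.mkQ) := by
  have := CompleteLattice.Iic_coatomic_of_compact_element ((Submodule.fg_iff_compact S).1 hS)
  have hbot : (⊥ : Set.Iic S) ≠ ⊤ := fun h => hS0 (congrArg Subtype.val h).symm
  obtain ⟨⟨L, hL⟩, hLc, -⟩ := (eq_top_or_exists_le_coatom (⊥ : Set.Iic S)).resolve_left hbot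
  have hcov : L ⋖ S := Set.Iic.isCoatom_iff.1 hLc
  have := (covBy_iff_quot_is_simple hL).1 hcov
  have hker : LinearMap.ker (L.mkQ ∘ₗ S.subtype) = L.comap S.subtype := by
    rw [LinearMap.ker_comp, Submodule.ker_mkQ]
  refine ⟨L, ?_⟩
  rw [← S.range_subtype, ← LinearMap.range_comp]
  exact IsSimpleModule.congr ((L.mkQ ∘ₗ S.subtype).quotKerEquivRange.symm.trans
    (Submodule.quotEquivOfEq _ _ hker))

theorem eq_zero_of_forall_mem_open {A M : Type*} [Ring A] [AddCommGroup M] [Module A M]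
    [TopologicalSpace M] [ContinuousAdd M] [T1Space M] [IsLinearTopology A M] {a : M}
    (h : ∀ I : Submodule A M, IsOpen (I : Set M) → a ∈ I) : a = 0 := by
  have hker : a ∈ (𝓝 (0 : M)).ker :=
    (IsLinearTopology.hasBasis_open_submodule (M := M) A).ker ▸ Set.mem_iInter₂.2 h
  rwa [ker_nhds] at hker

theorem IsTopLeftTNilpotent.op_smul_eq_zero {R M : Type*} [Ring R] [TopologicalSpace R]
    [AddCommGroup M] [Module Rᵐᵒᵖ M] [IsDiscreteRightModule R M] [IsSimpleModule Rᵐᵒᵖ M]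
    {H : Ideal R} (hT : IsTopLeftTNilpotent H) {h : R} (hh : h ∈ H) (b : M) :
    MulOpposite.op h • b = 0 := by
  by_contra hb
  have hclosure : 0 ∈ closure {a : R | MulOpposite.op a • b ≠ 0} := by
    refine hT.zero_mem_closure ?_ fun a ha => ?_
    · rw [Set.mem_ofPred_eq, MulOpposite.op_one, one_smul]
      rintro rfl
      exact hb (smul_zero _)
    · obtain ⟨c, hc⟩ := IsSimpleModule.toSpanSingleton_surjective Rᵐᵒᵖ ha b
      have hc' : MulOpposite.op (a * (c.unop * h)) • b = MulOpposite.op h • b := by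
        rw [MulOpposite.op_mul, MulOpposite.op_mul, MulOpposite.op_unop, mul_smul, mul_smul]
        exact congrArg _ hc
      exact ⟨c.unop * h, H.mul_mem_left _ hh, fun h0 => hb (hc'.symm.trans h0)⟩
  obtain ⟨a, ha, ha'⟩ := mem_closure_iff.1 hclosure _ (IsDiscreteRightModule.isOpen_annihilator b)
    (zero_smul Rᵐᵒᵖ b)
  exact ha' ha

namespace CoordinateSystem

variable {R : Type u} [Ring R] [UniformSpace R] [IsUniformAddGroup R] [IsTopologicalRing R]
  [CompleteSpace R] [T2Space R] [IsLinearTopology Rᵐᵒᵖ R] {H : Ideal R} [H.IsTwoSided]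
  {F : Contramodule R} {X : Type u} (B : CoordinateSystem H F X)
include B

open FormalSum Contramodule Contratensor IsDiscreteRightModule

theorem exists_hom_tmul_f {M : Type*} [AddCommGroup M] [Module Rᵐᵒᵖ M] [IsDiscreteRightModule R M]
    (hM : ∀ h ∈ H, ∀ m : M, MulOpposite.op h • m = 0) (x : X) :
    ∃ ψ : Contratensor M F →+ M, (∀ m, ψ (tmul M F m (B.f x)) = MulOpposite.op (B.e x) • m) ∧
      ∀ x' ≠ x, ∀ m, ψ (tmul M F m (B.f x')) = 0 := by
  let μ : R ⧸ H →+ M →+ M := QuotientAddGroup.lift H.toAddSubgroup (smulHom R M)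
    fun h hh => AddMonoidHom.ext (hM h hh)
  have hμ (a : R) (z : R ⧸ H) (m : M) : μ (a • z) m = μ z (MulOpposite.op a • m) := by
    obtain ⟨b, rfl⟩ := H.mkQ_surjective z
    exact mul_smul (MulOpposite.op b) (MulOpposite.op a) m
  have h0 (m : M) : μ 0 m = 0 := DFunLike.congr_fun (map_zero μ) m
  obtain ⟨V, hV, hVφ⟩ := B.exists_isOpen x
  obtain ⟨ψ, hψ⟩ := exists_hom_tmul (μ.flip.compl₂ (B.φ x).toAddMonoidHom)
    (fun m => ⟨V, hV, fun r hr => (congrArg (μ · m) (hVφ r hr)).trans (h0 m)⟩)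
    fun m a c => (congrArg (μ · m) (map_smul (B.φ x) a c)).trans (hμ a _ m)
  refine ⟨ψ, fun m => (hψ m _).trans ?_, fun x' hx' m => (hψ m _).trans ?_⟩
  · exact congrArg (μ · m) (B.φ_self x)
  · exact (congrArg (μ · m) (B.φ_of_ne hx'.symm)).trans (h0 m)

theorem op_smul_eq_zero_of_sum_tmul_eq_zero {M : Type*} [AddCommGroup M] [Module Rᵐᵒᵖ M]
    [IsDiscreteRightModule R M] (hM : ∀ h ∈ H, ∀ m : M, MulOpposite.op h • m = 0) {m : X →₀ M}
    (hm : (m.sum fun x n => tmul M F n (B.f x)) = 0) (x : X) :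
    MulOpposite.op (B.e x) • m x = 0 := by
  obtain ⟨ψ, hψ, hψ'⟩ := B.exists_hom_tmul_f hM x
  rw [← hψ, ← map_zero ψ, ← hm, map_finsuppSum]
  refine (Finsupp.sum_eq_single (g := fun x' n => ψ (tmul M F n (B.f x'))) x
    (fun x' _ hx' => hψ' x' hx' _) fun _ => ?_).symm
  rw [map_zero, AddMonoidHom.zero_apply, map_zero]

/-- Flatness moves the relation `∑ b rₓ ⊗ fₓ = 0` from `N ⊙ F` to `M ⊙ F`, where it can be tested
on coordinates because `M` is a module over `R ⧸ H`. -/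
theorem op_smul_eq_zero_of_lin_eq_zero (hF : F.Flat) {r : FormalSum R X}
    (hre : ∀ x, r.1 x * B.e x = r.1 x) (hr : lin B.f r = 0) {N : Type u} [AddCommGroup N]
    [Module Rᵐᵒᵖ N] [IsDiscreteRightModule R N] {M : Submodule Rᵐᵒᵖ N}
    (hM : ∀ h ∈ H, ∀ m : M, MulOpposite.op h • m = 0) {b : N}
    (hb : ∀ x, MulOpposite.op (r.1 x) • b ∈ M) (x : X) : MulOpposite.op (r.1 x) • b = 0 := by
  let m : X →₀ M := Finsupp.ofSupportFinite (fun x => ⟨_, hb x⟩)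
    ((smulLeft b r).hasFiniteSupport.subset fun x hx h => hx (Subtype.ext h))
  have hmb : m.mapRange M.subtype (map_zero _) = smulLeft b r := Finsupp.ext fun _ => rfl
  have hinj := (hF M N (N ⧸ M) M.subtype M.mkQ M.injective_subtype
    (LinearMap.exact_subtype_mkQ M) M.mkQ_surjective).1
  have hm : (m.sum fun x n => tmul M F n (B.f x)) = 0 := by
    refine hinj ?_
    rw [map_zero, map_finsuppSum, ← map_zero (tmul N F b), ← hr, tmul_lin, ← hmb,
      Finsupp.sum_mapRange_index fun x => by rw [map_zero, AddMonoidHom.zero_apply]]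
    rfl
  have hx := congrArg M.subtype (B.op_smul_eq_zero_of_sum_tmul_eq_zero hM hm x)
  rw [map_smul, map_zero] at hx
  rw [← hre x, MulOpposite.op_mul, mul_smul]
  exact hx

theorem eq_zero_of_lin_eq_zero (hT : IsTopLeftTNilpotent H) (hF : F.Flat) {r : FormalSum R X}
    (hre : ∀ x, r.1 x * B.e x = r.1 x) (hr : lin B.f r = 0) : r = 0 := by
  refine ext_apply fun x => eq_zero_of_forall_mem_open (A := Rᵐᵒᵖ) fun I hI => ?_
  have := IsDiscreteRightModule.quotient hI
  have hr1 (x : X) : smulLeft (I.mkQ 1) r x = I.mkQ (r.1 x) := by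
    rw [smulLeft_apply, ← map_smul, op_smul_eq_mul, one_mul]
  let S : Submodule Rᵐᵒᵖ (R ⧸ I) := Submodule.span _ (Set.range (smulLeft (I.mkQ 1) r))
  have hS (x : X) : I.mkQ (r.1 x) ∈ S := Submodule.subset_span ⟨x, hr1 x⟩
  suffices hS0 : S = ⊥ from
    (Submodule.Quotient.mk_eq_zero I).1 ((Submodule.mem_bot Rᵐᵒᵖ).1 (hS0 ▸ hS x))
  by_contra hne
  obtain ⟨L, hL⟩ := exists_isSimpleModule_map_mkQ (Submodule.fg_span (Finsupp.finite_range _)) hne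
  have hmem (x : X) : MulOpposite.op (r.1 x) • L.mkQ (I.mkQ 1) ∈ S.map L.mkQ := by
    rw [← map_smul, ← smulLeft_apply, hr1]
    exact Submodule.mem_map_of_mem (hS x)
  have hzero := B.op_smul_eq_zero_of_lin_eq_zero hF hre hr (M := S.map L.mkQ)
    (fun h hh m => hT.op_smul_eq_zero hh m) hmem
  have hSL : S ≤ L := Submodule.span_le.2 <| by
    rintro _ ⟨x, rfl⟩
    rw [smulLeft_apply]
    exact (Submodule.Quotient.mk_eq_zero L).1 (hzero x)
  have hmap : S.map L.mkQ = ⊥ := LinearMap.le_ker_iff_map.1 (L.ker_mkQ.symm ▸ hSL)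
  exact (Submodule.nontrivial_iff_ne_bot.1 (IsSimpleModule.nontrivial Rᵐᵒᵖ _)) hmap

end CoordinateSystem

section Projectivity

variable {R : Type u} [Ring R] [UniformSpace R] [IsUniformAddGroup R] [IsTopologicalRing R]
  [CompleteSpace R] [T2Space R] [IsLinearTopology Rᵐᵒᵖ R] {H : Ideal R} [H.IsTwoSided]

open FormalSum Contramodule

namespace CoordinateSystem

variable {F : Contramodule R} {X : Type u} (B : CoordinateSystem H F X)
include B

theorem exists_lin_eq (hT : IsTopLeftTNilpotent H) (c : F.carrier) :
    ∃ r : FormalSum R X, (∀ x, r.1 x * B.e x = r.1 x) ∧ lin B.f r = c := by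
  have hspan : (lin B.f).range = ⊤ :=
    (isSubcontramodule_range_lin B.f).eq_top_of_forall_exists_sub_mem hT fun c =>
      (B.exists_sub_lin_mem_idealSpan c).elim fun r hr => ⟨_, ⟨r, rfl⟩, hr⟩
  obtain ⟨r, hr⟩ : c ∈ (lin B.f).range := hspan ▸ AddSubgroup.mem_top c
  refine ⟨mulRight B.e r, fun x => ?_, ?_⟩
  · rw [mulRight_apply, mul_assoc, (B.isIdempotentElem x).eq]
  · rw [lin_mulRight, funext B.e_smul_f, hr]

theorem projective (hT : IsTopLeftTNilpotent H) (hF : F.Flat) : Projective F := by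
  choose ρ hρe hρ using B.exists_lin_eq hT
  have hinj {r s : FormalSum R X} (hr : ∀ x, r.1 x * B.e x = r.1 x)
      (hs : ∀ x, s.1 x * B.e x = s.1 x) (hrs : lin B.f r = lin B.f s) : r = s := by
    refine sub_eq_zero.1 (B.eq_zero_of_lin_eq_zero hT hF (fun x => ?_) ?_)
    · exact (sub_mul _ _ _).trans (congrArg₂ _ (hr x) (hs x))
    · rw [map_sub, hrs, sub_self]
  have hkleisli (r : FormalSum R F.carrier) (x : X) :
      (kleisli ρ r).1 x * B.e x = (kleisli ρ r).1 x := by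
    have h (c : F.carrier) : mulRight B.e (ρ c) = ρ c :=
      ext_apply fun x => (mulRight_apply B.e (ρ c) x).trans (hρe c x)
    rw [← mulRight_apply, mulRight, kleisli_kleisli]
    exact congrArg (fun G => (kleisli G r).1 x) (funext h)
  refine projective_of_section B.f ρ hρ fun r => hinj (hρe _) (hkleisli r) ?_
  rw [hρ, lin_kleisli, funext hρ]
  exact (lin_id r).symm

end CoordinateSystem

end Projectivity

section ProductDecomposition

variable {R : Type u} [Ring R] [TopologicalSpace R] [IsTopologicalRing R] {H : Ideal R}
  [H.IsTwoSided] {Γ : Type v} {S : Γ → Type w} [∀ γ, Ring (S γ)] [∀ γ, TopologicalSpace (S γ)]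
  [∀ γ, DiscreteTopology (S γ)]

namespace IsStronglyClosed

theorem exists_forall_sub_mem (hH : IsStronglyClosed H) (e : R ⧸ H ≃+* ((γ : Γ) → S γ))
    (he : IsHomeomorph e) {X : Type u} {s : X → R}
    (hs : ∀ γ, {x | e (Ideal.Quotient.mk H (s x)) γ ≠ 0}.Finite) :
    ∃ r : FormalSum R X, ∀ x, r.1 x - s x ∈ H := by
  have ht : Tendsto (fun x => Ideal.Quotient.mk H (s x)) cofinite (𝓝 0) := by
    rw [he.isEmbedding.tendsto_nhds_iff, map_zero, tendsto_pi_nhds]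
    intro γ
    rw [Pi.zero_apply, nhds_discrete, tendsto_pure]
    exact hs γ
  obtain ⟨r, hr⟩ := hH.surjective X ⟨_, ht⟩
  refine ⟨r, fun x => ?_⟩
  rw [← Ideal.Quotient.mk_eq_mk_iff_sub_mem]
  exact congrFun (congrArg Subtype.val hr) x

/-- Indexing the factors by their kernels keeps the index set in the universe of `R`. -/
theorem exists_semisimpleDecomposition (hH : IsStronglyClosed H) [∀ γ, IsSemisimpleRing (S γ)]
    (e : R ⧸ H ≃+* ((γ : Γ) → S γ)) (he : IsHomeomorph e) :
    ∃ Γ' : Type u, Nonempty (SemisimpleDecomposition H Γ') := by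
  classical
  let q (γ : Γ) : R →+* S γ := (Pi.evalRingHom S γ).comp (e.toRingHom.comp (Ideal.Quotient.mk H))
  have hqc (γ : Γ) : Continuous (q γ) :=
    (continuous_apply γ).comp (he.continuous.comp H.continuous_mkQ)
  have hqs (γ : Γ) : Function.Surjective (q γ) :=
    (Function.surjective_eval γ).comp (e.surjective.comp Ideal.Quotient.mk_surjective)
  have hqH {a : R} : a ∈ H ↔ ∀ γ, q γ a = 0 := by
    rw [← Ideal.Quotient.eq_zero_iff_mem, ← e.map_eq_zero_iff, funext_iff]
    rfl
  choose σ hσ using fun K : Set.range fun γ => RingHom.ker (q γ) => K.2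
  choose s hs using fun K => Ideal.Quotient.mk_surjective (I := H) (e.symm (Pi.single (σ K) 1))
  have hqs_eq (K) (γ : Γ) : q γ (s K) = (Pi.single (σ K) 1 : (γ : Γ) → S γ) γ := by
    simp only [q, RingHom.comp_apply, hs]
    exact congrFun (e.apply_symm_apply _) γ
  have hσi : Function.Injective σ := fun K K' h => Subtype.ext <| by rw [← hσ, ← hσ, h]
  obtain ⟨ε, hε⟩ := hH.exists_forall_sub_mem e he (s := s) fun γ => by
    refine ((Set.finite_singleton γ).preimage hσi.injOn).subset fun K hK => ?_
    by_contra hne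
    exact hK ((hqs_eq K γ).trans (Pi.single_eq_of_ne' hne _))
  have hqε (K) (γ : Γ) : q γ (ε.1 K) = (Pi.single (σ K) 1 : (γ : Γ) → S γ) γ := by
    rw [← hqs_eq, ← sub_eq_zero, ← map_sub, hqH.1 (hε K)]
  exact ⟨_, ⟨{
    K := fun K => RingHom.ker (q (σ K))
    isTwoSided := fun _ => inferInstance
    isOpen := fun K => (isOpen_discrete {(0 : S (σ K))}).preimage (hqc (σ K))
    isSemisimpleRing := fun K =>
      (RingHom.quotientKerEquivOfSurjective (hqs (σ K))).symm.isSemisimpleRing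
    ε := ε
    ε_mem := fun h => (hqε _ _).trans (Pi.single_eq_of_ne (hσi.ne h) _)
    ε_sub_one_mem := fun K => by
      rw [RingHom.mem_ker, map_sub, hqε, Pi.single_eq_same, map_one, sub_self]
    mem_iff := fun {a} => hqH.trans ⟨fun h K => h (σ K), fun h γ =>
      (hσ ⟨_, γ, rfl⟩).le (h ⟨_, γ, rfl⟩)⟩
    exists_lift := fun {X} t ht => hH.exists_forall_sub_mem e he fun γ =>
      (ht ⟨_, γ, rfl⟩).subset fun x hx hmem => hx ((hσ ⟨_, γ, rfl⟩).le hmem) }⟩⟩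

end IsStronglyClosed

end ProductDecomposition

theorem corollary8p4_general {R : Type u} [Ring R] [UniformSpace R] [IsUniformAddGroup R]
    [IsTopologicalRing R] [CompleteSpace R] [T2Space R] [IsLinearTopology Rᵐᵒᵖ R]
    (H : Ideal R) [H.IsTwoSided] (hH : IsStronglyClosed H) (hT : IsTopLeftTNilpotent H)
    {Γ : Type v} (S : Γ → Type w) [∀ γ, Ring (S γ)] [∀ γ, TopologicalSpace (S γ)]
    [∀ γ, DiscreteTopology (S γ)] [∀ γ, IsSemisimpleRing (S γ)]
    (e : R ⧸ H ≃+* ((γ : Γ) → S γ)) (he : IsHomeomorph e)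
    (F : Contramodule R) (hF : F.Flat) :
    Projective F := by
  obtain ⟨_, ⟨D⟩⟩ := hH.exists_semisimpleDecomposition e he
  obtain ⟨_, ⟨B⟩⟩ := D.exists_coordinateSystem hT F
  exact B.projective hT hF

theorem corollary8p4 {R : Type u} [Ring R] [UniformSpace R] [IsUniformAddGroup R]
    [IsTopologicalRing R] [CompleteSpace R] [T2Space R] [IsLinearTopology Rᵐᵒᵖ R]
    (H : Ideal R) [H.IsTwoSided] (hH : IsStronglyClosed H) (hT : IsTopLeftTNilpotent H)
    {Γ : Type v} (S : Γ → Type w) [∀ γ, Ring (S γ)] [∀ γ, TopologicalSpace (S γ)]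
    [∀ γ, DiscreteTopology (S γ)] [∀ γ, IsSimpleRing (S γ)] [∀ γ, IsArtinianRing (S γ)]
    (e : R ⧸ H ≃+* ((γ : Γ) → S γ)) (he : IsHomeomorph e)
    (F : Contramodule R) (hF : F.Flat) :
    Projective F :=
  have := fun γ => (IsSimpleRing.isSemisimpleRing_iff_isArtinianRing (R := S γ)).2 inferInstance
  corollary8p4_general H hH hT S e he F hF
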